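/- **Setting.** Messages are ground terms built from countably infinitely many names, the constructors $\mathsf{pub}(M)$, $\mathsf{sign}(M,N)$, $\mathsf{blind}(M,N)$, pairing $\langle M,N\rangle$ and symmetric encryption $\{M\}_N$, and the symbols of a signature $\Sigma_E$ disjoint from the constructors (at most countable, with uniformly bounded arities; for example finite). $E$ is an equational theory over $\Sigma_E$ with at most one associative-commutative (AC) symbol $\oplus$, given by rewrite rules $R_E$ between $\Sigma_E$-terms with variables, where every variable of a right-hand side occurs in the left-hand side. Write $\equiv$ for equality modulo AC of $\oplus$ and $\approx_E$ for equality modulo $R_E$ and AC. $E$ is assumed convergent: the relation $\equiv\circ\to_{R_E}\circ\equiv$ is terminating, and confluent modulo $\equiv$. A sequent $\Gamma\vdash M$ ($\Gamma$ a finite set of messages) is in normal form if $M$ and all members of $\Gamma$ are irreducible for that relation; only such sequents are considered. An $E$-context is a term with holes built from symbols of $\Sigma_E$ only. *Elementary deduction* $\Gamma\Vdash_E M$ holds if $C[M_1,\dots,M_k]\approx_E M$ for some $E$-context $C$ and $M_1,\dots,M_k\in\Gamma$. An $E$-factor of a message is a constructor-headed immediate subterm of a subterm headed by a symbol of $\Sigma_E$.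 **Deduction systems.** * $\mathcal N$ (natural deduction, fixed $\Gamma$): every $M\in\Gamma$ is derivable; $\langle M,N\rangle$, $\{M\}_N$, $\mathsf{sign}(M,N)$, $\mathsf{blind}(M,N)$ are derivable from $M$ and $N$; $f(M_1,\dots,M_m)$ is derivable from $M_1,\dots,M_m$ for $f\in\Sigma_E$; $M$ and $N$ from $\langle M,N\rangle$; $M$ from $\{M\}_K$ and $K$; $M$ from $\mathsf{sign}(M,K)$ and $\mathsf{pub}(K)$; $M$ from $\mathsf{blind}(M,K)$ and $K$; $\mathsf{sign}(M,K)$ from $\mathsf{sign}(\mathsf{blind}(M,R),K)$ and $R$; and $M$ from $N$ if $M\approx_E N$. * $\mathcal R$: $\Gamma\vdash M$ is an axiom ($id$) if $\Gamma\Vdash_E M$; the right rules derive $\Gamma\vdash\langle M,N\rangle$, $\Gamma\vdash\{M\}_N$, $\Gamma\vdash\mathsf{sign}(M,N)$, $\Gamma\vdash\mathsf{blind}(M,N)$ from $\Gamma\vdash M$ and $\Gamma\vdash N$. * $\mathcal S$ (sequent calculus): $id$, the right rules, cut (from $\Gamma\vdash M$ and $\Gamma,M\vdash T$ infer $\Gamma\vdash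 T$), and left rules inferring $\Gamma\vdash T$ as follows: from $\Gamma,M,N\vdash T$ if $\langle M,N\rangle\in\Gamma$; from $\Gamma\vdash K$ and $\Gamma,M,K\vdash T$ if $\{M\}_K\in\Gamma$ or $\mathsf{blind}(M,K)\in\Gamma$; from $\Gamma,M\vdash T$ if $\mathsf{sign}(M,K),\mathsf{pub}(L)\in\Gamma$ with $K\equiv L$; from $\Gamma\vdash R$ and $\Gamma,\mathsf{sign}(M,K),R\vdash T$ if $\mathsf{sign}(\mathsf{blind}(M,R),K)\in\Gamma$; and from $\Gamma\vdash A$ and $\Gamma,A\vdash T$ if $A$ is an $E$-factor of a member of $\Gamma\cup\{T\}$. * $\mathcal L$ (linear system): $\Gamma\vdash M$ is an axiom if it is derivable in $\mathcal R$; the left rules are those of $\mathcal S$, except that each left premise $\Gamma\vdash K$, $\Gamma\vdash R$, $\Gamma\vdash A$ is replaced by the side condition that it be derivable in $\mathcal R$; there is no cut and there are no right rules. **Complexity.** Let $pst(\Delta)$ be the set of proper subterms of members of $\Delta$ and $St(\Delta)=\Delta\cup pst(\Delta)\cup\{\mathsf{sign}(M,N): M,N\in pst(\Delta)\}$. An instance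 $\Gamma\vdash M$ of a deduction problem (elementary deduction included) is given as a maximally shared DAG with one node for each element of $St(\Gamma\cup\{M\})$, each node tagged with whether it belongs to $\Gamma$ and whether it is $M$; its size is $n=\#St(\Gamma\cup\{M\})$. A problem has complexity $O(f(n))$ if some program decides it on all sequents in normal form within $c\cdot f(n)$ steps, for some constant $c$. The machine model is that of while-programs on S-expressions over atoms: the unit-cost operations are forming and taking apart pairs, testing whether a value is a pair, constants, and comparing atoms; names, symbols and node addresses are atoms. **Theorem.** For every such $E$: 1. For every sequent in normal form, $\Gamma\vdash M$ is derivable in $\mathcal L$ if and only if it is derivable in $\mathcal S$, if and only if it is derivable in $\mathcal N$. 2. Deducibility in $\mathcal L$ (equivalently $\mathcal S$, equivalently $\mathcal N$) is polynomially reducible to elementary deduction: there is a constant $k$ such that for every nondecreasing $f:\mathbb N\to\mathbb N$, if elementary deduction for $E$ has complexity $O(f(n))$, then deducibility has complexity $O(n^k\cdot f(n))$. 3. If $E$ has no equations (no rewrite rules and no AC symbol), then deducibility in $\mathcal L$, $\mathcal S$ and $\mathcal N$ has complexity $O(n^k)$ for some constant $k$; in particular intruder deduction with blind signatures (the case $\Sigma_E=\emptyset$)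 is decidable in polynomial time. -/

import Mathlib

namespace IntruderDeduction

/-! ### Messages -/

/-- The signature of an equational theory: at most countably many function symbols
(`code` numbers them, for use in machine inputs), of uniformly bounded arity.
Every finite signature is of this kind. -/
structure Signature where
  Sym : Type
  arity : Sym → ℕ
  code : Sym → ℕ
  code_injective : Function.Injective code
  arity_bounded : ∃ B : ℕ, ∀ f : Sym, arity f ≤ B

/-- The constructors; they are disjoint from the symbols of the equational theory. -/
inductive Con
  | pub
  | sign
  | blind
  | pair
  | enc

def Con.arity : Con → ℕ
  | .pub => 1
  | .sign => 2
  | .blind => 2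
  | .pair => 2
  | .enc => 2

/-- A number identifying a constructor, for use in machine inputs. -/
def Con.code : Con → ℕ
  | .pub => 0
  | .sign => 1
  | .blind => 2
  | .pair => 3
  | .enc => 4

/-- The arity of a constructor or of a symbol of the equational theory. -/
def Signature.headArity (S : Signature) : Con ⊕ S.Sym → ℕ
  | .inl c => c.arity
  | .inr f => S.arity f

/-- Ground messages: built from countably many names by constructors and by symbols of `S`. -/
inductive Msg (S : Signature) : Type
  | name (a : ℕ) : Msg S
  | node (g : Con ⊕ S.Sym) (args : Fin (S.headArity g) → Msg S) : Msg S

namespace Msg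

variable {S : Signature}

/-- The public key of `M`. -/
def pub (M : Msg S) : Msg S := .node (.inl .pub) ![M]
/-- `M` signed with `N`. -/
def sign (M N : Msg S) : Msg S := .node (.inl .sign) ![M, N]
/-- `M` blinded with `N`. -/
def blind (M N : Msg S) : Msg S := .node (.inl .blind) ![M, N]
/-- The pair of `M` and `N`. -/
def pair (M N : Msg S) : Msg S := .node (.inl .pair) ![M, N]
/-- `M` encrypted with the key `N`. -/
def enc (M N : Msg S) : Msg S := .node (.inl .enc) ![M, N]
/-- `f (args 0, …)` for a symbol `f` of the equational theory. -/
def app (f : S.Sym) (args : Fin (S.arity f) → Msg S) : Msg S := .node (.inr f) args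

/-- `M` is an immediate subterm of `N`. -/
def Imm (M N : Msg S) : Prop := ∃ g args i, N = .node g args ∧ M = args i

/-- `M` is a subterm of `N`. -/
def Subterm (M N : Msg S) : Prop := Relation.ReflTransGen Imm M N

/-- `M` is a proper subterm of `N`. -/
def ProperSubterm (M N : Msg S) : Prop := Subterm M N ∧ M ≠ N

/-- `M` is headed by a symbol of the equational theory. -/
def HeadedByE (M : Msg S) : Prop := ∃ f args, M = app f args

/-- `M` is an alien term: headed by a symbol outside the equational theory
(so names are not alien). -/
def Alien (M : Msg S) : Prop := ∃ c args, M = .node (.inl c) args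

/-- `M` is an `E`-factor of `N`: an alien immediate subterm of a subterm of `N` that is headed
by a symbol of the equational theory. -/
def IsFactor (M N : Msg S) : Prop :=
  M.Alien ∧ ∃ F : Msg S, Subterm F N ∧ F.HeadedByE ∧ Imm M F

end Msg

/-- `A` is an `E`-factor of the set `Γ`. -/
def FactorOf {S : Signature} (A : Msg S) (Γ : Set (Msg S)) : Prop := ∃ N ∈ Γ, A.IsFactor N

/-- The set of proper subterms of the terms in `Γ`. -/
def pst {S : Signature} (Γ : Set (Msg S)) : Set (Msg S) :=
  {M | ∃ N ∈ Γ, M.ProperSubterm N}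

/-- All signatures `sign M N` with `M` and `N` in `pst Γ`. -/
def sst {S : Signature} (Γ : Set (Msg S)) : Set (Msg S) :=
  {T | ∃ M ∈ pst Γ, ∃ N ∈ pst Γ, T = Msg.sign M N}

/-- The saturated set of `Γ`. -/
def St {S : Signature} (Γ : Set (Msg S)) : Set (Msg S) := Γ ∪ pst Γ ∪ sst Γ

/-! ### Equational theories and rewriting modulo AC -/

/-- Terms over the symbols of `S` alone, with variables (or holes) in `V`. -/
inductive Pat (S : Signature) (V : Type) : Type
  | var (x : V) : Pat S V
  | app (f : S.Sym) (args : Fin (S.arity f) → Pat S V) : Pat S V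

/-- Replace the variables of a term by messages. -/
def Pat.subst {S : Signature} {V : Type} (σ : V → Msg S) : Pat S V → Msg S
  | .var x => σ x
  | .app f args => Msg.app f (fun i => (args i).subst σ)

/-- The variables that occur in a term. -/
def Pat.vars {S : Signature} {V : Type} : Pat S V → Set V
  | .var x => {x}
  | .app _ args => ⋃ i, (args i).vars

/-- `f (p, q)` for a binary symbol `f`. -/
def Pat.binary {S : Signature} {V : Type} (f : S.Sym) (p q : Pat S V) : Pat S V :=
  .app f (fun i => if (i : ℕ) = 0 then p else q)

/-- One rewrite step, anywhere inside a message, with a pair from `A` used from left to right. -/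
inductive Step {S : Signature} (A : Set (Pat S ℕ × Pat S ℕ)) : Msg S → Msg S → Prop
  | root (e : Pat S ℕ × Pat S ℕ) (he : e ∈ A) (σ : ℕ → Msg S) :
      Step A (e.1.subst σ) (e.2.subst σ)
  | arg (g : Con ⊕ S.Sym) (args : Fin (S.headArity g) → Msg S) (i : Fin (S.headArity g))
      (N : Msg S) (h : Step A (args i) N) :
      Step A (.node g args) (.node g (Function.update args i N))

/-- An equational theory presented by rewrite rules modulo associativity and commutativity
of at most one binary symbol `plus`. -/
structure Theory (S : Signature) where
  plus : Option S.Sym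
  plus_arity : ∀ f, plus = some f → S.arity f = 2
  rules : Set (Pat S ℕ × Pat S ℕ)
  vars_subset : ∀ r ∈ rules, r.2.vars ⊆ r.1.vars

namespace Theory

variable {S : Signature} (E : Theory S)

/-- The commutativity and associativity axioms of `plus`. -/
def acAxioms : Set (Pat S ℕ × Pat S ℕ) :=
  {e | ∃ f, E.plus = some f ∧
    (e = (.binary f (.var 0) (.var 1), .binary f (.var 1) (.var 0)) ∨
     e = (.binary f (.binary f (.var 0) (.var 1)) (.var 2),
          .binary f (.var 0) (.binary f (.var 1) (.var 2))))}

/-- `M ≡ N`: equality modulo associativity and commutativity of `plus`. -/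
def ACEq (M N : Msg S) : Prop := Relation.EqvGen (Step E.acAxioms) M N

/-- `M ≈ N`: equality modulo the whole theory. -/
def Eqv (M N : Msg S) : Prop := Relation.EqvGen (Step (E.rules ∪ E.acAxioms)) M N

/-- `M → N`: one step of rewriting modulo AC. -/
def Rew (M N : Msg S) : Prop := ∃ M' N', E.ACEq M M' ∧ Step E.rules M' N' ∧ E.ACEq N' N

/-- Termination and confluence modulo AC. Names are free constants that occur in no rule, and
there are infinitely many, so considering messages without variables is no restriction. -/
def Convergent : Prop :=
  WellFounded (fun N M => E.Rew M N) ∧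
  ∀ M N₁ N₂, Relation.ReflTransGen E.Rew M N₁ → Relation.ReflTransGen E.Rew M N₂ →
    ∃ P₁ P₂, Relation.ReflTransGen E.Rew N₁ P₁ ∧ Relation.ReflTransGen E.Rew N₂ P₂ ∧
      E.ACEq P₁ P₂

/-- `M` is in normal form. -/
def Normal (M : Msg S) : Prop := ∀ N, ¬ E.Rew M N

/-- The sequent `Γ ⊢ M` is in normal form. -/
def NormalSequent (Γ : Set (Msg S)) (M : Msg S) : Prop := (∀ N ∈ Γ, E.Normal N) ∧ E.Normal M

/-- The theory has no equations at all. -/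
def NoEquations : Prop := E.rules = ∅ ∧ E.plus = none

/-! ### Deduction systems -/

/-- Elementary deduction: `C[M₁, …, Mₖ] ≈ M` for some `E`-context `C` and `M₁, …, Mₖ ∈ Γ`.
(A hole of `C` may be used repeatedly, which is harmless since the `Mᵢ` may coincide.) -/
def Elementary (Γ : Set (Msg S)) (M : Msg S) : Prop :=
  ∃ (k : ℕ) (C : Pat S (Fin k)) (Ms : Fin k → Msg S), (∀ i, Ms i ∈ Γ) ∧ E.Eqv (C.subst Ms) M

/-- The natural deduction system `𝓝`. -/
inductive NDer (Γ : Set (Msg S)) : Msg S → Prop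
  | id {M} : M ∈ Γ → NDer Γ M
  | encE {M K} : NDer Γ (.enc M K) → NDer Γ K → NDer Γ M
  | encI {M K} : NDer Γ M → NDer Γ K → NDer Γ (.enc M K)
  | pairE₁ {M N} : NDer Γ (.pair M N) → NDer Γ M
  | pairE₂ {M N} : NDer Γ (.pair M N) → NDer Γ N
  | pairI {M N} : NDer Γ M → NDer Γ N → NDer Γ (.pair M N)
  | signE {M K} : NDer Γ (.sign M K) → NDer Γ (.pub K) → NDer Γ M
  | signI {M K} : NDer Γ M → NDer Γ K → NDer Γ (.sign M K)
  | blindE₁ {M K} : NDer Γ (.blind M K) → NDer Γ K → NDer Γ M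
  | blindI {M K} : NDer Γ M → NDer Γ K → NDer Γ (.blind M K)
  | blindE₂ {M R K} : NDer Γ (.sign (.blind M R) K) → NDer Γ R → NDer Γ (.sign M K)
  | appI {f} {args : Fin (S.arity f) → Msg S} :
      (∀ i, NDer Γ (args i)) → NDer Γ (.app f args)
  | conv {M N} : E.Eqv M N → NDer Γ N → NDer Γ M

/-- The sequent system `𝓢`. Only sequents in normal form are considered, so the cut formula is
in normal form; all other rules introduce only normal terms when read upwards from a sequent
in normal form. -/
inductive SDer : Set (Msg S) → Msg S → Prop
  | id {Γ M} : E.Elementary Γ M → SDer Γ M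
  | cut {Γ M T} : E.Normal M → SDer Γ M → SDer (insert M Γ) T → SDer Γ T
  | pairL {Γ M N T} : .pair M N ∈ Γ → SDer (insert M (insert N Γ)) T → SDer Γ T
  | pairR {Γ M N} : SDer Γ M → SDer Γ N → SDer Γ (.pair M N)
  | encL {Γ M K T} : .enc M K ∈ Γ → SDer Γ K → SDer (insert M (insert K Γ)) T → SDer Γ T
  | encR {Γ M K} : SDer Γ M → SDer Γ K → SDer Γ (.enc M K)
  | signL {Γ M K L T} : .sign M K ∈ Γ → .pub L ∈ Γ → E.ACEq K L →
      SDer (insert M Γ) T → SDer Γ T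
  | signR {Γ M K} : SDer Γ M → SDer Γ K → SDer Γ (.sign M K)
  | blindL₁ {Γ M K T} : .blind M K ∈ Γ → SDer Γ K → SDer (insert M (insert K Γ)) T → SDer Γ T
  | blindR {Γ M K} : SDer Γ M → SDer Γ K → SDer Γ (.blind M K)
  | blindL₂ {Γ M R K T} : .sign (.blind M R) K ∈ Γ → SDer Γ R →
      SDer (insert (.sign M K) (insert R Γ)) T → SDer Γ T
  | acut {Γ A M} : FactorOf A (insert M Γ) → SDer Γ A → SDer (insert A Γ) M → SDer Γ M

/-- Derivability with the right rules and `id` only. -/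
inductive RDer (Γ : Set (Msg S)) : Msg S → Prop
  | id {M} : E.Elementary Γ M → RDer Γ M
  | pairR {M N} : RDer Γ M → RDer Γ N → RDer Γ (.pair M N)
  | encR {M K} : RDer Γ M → RDer Γ K → RDer Γ (.enc M K)
  | signR {M K} : RDer Γ M → RDer Γ K → RDer Γ (.sign M K)
  | blindR {M K} : RDer Γ M → RDer Γ K → RDer Γ (.blind M K)

/-- The linear proof system `𝓛`. -/
inductive LDer : Set (Msg S) → Msg S → Prop
  | r {Γ M} : E.RDer Γ M → LDer Γ M
  | le {Γ M K T} : .enc M K ∈ Γ → E.RDer Γ K → LDer (insert M (insert K Γ)) T → LDer Γ T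
  | lp {Γ M N T} : .pair M N ∈ Γ → LDer (insert M (insert N Γ)) T → LDer Γ T
  | sign {Γ M K L T} : .sign M K ∈ Γ → .pub L ∈ Γ → E.ACEq K L →
      LDer (insert M Γ) T → LDer Γ T
  | blind₁ {Γ M K T} : .blind M K ∈ Γ → E.RDer Γ K → LDer (insert M (insert K Γ)) T → LDer Γ T
  | blind₂ {Γ M R K T} : .sign (.blind M R) K ∈ Γ → E.RDer Γ R →
      LDer (insert (.sign M K) (insert R Γ)) T → LDer Γ T
  | ls {Γ A M} : FactorOf A (insert M Γ) → E.RDer Γ A → LDer (insert A Γ) M → LDer Γ M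

end Theory

/-! ### The machine model: while-programs on S-expressions, with a step count -/

/-- S-expressions. Atoms can only be copied and compared for equality. -/
inductive Val
  | atom (a : ℕ) : Val
  | pair (x y : Val) : Val

namespace Val

def fst : Val → Val
  | .atom _ => .atom 0
  | .pair x _ => x

def snd : Val → Val
  | .atom _ => .atom 0
  | .pair _ y => y

/-- `1` on a compound value, `0` on an atom. -/
def isPair : Val → Val
  | .atom _ => .atom 0
  | .pair _ _ => .atom 1

/-- `1` on a pair of two equal atoms, `0` on everything else. -/
def eqAtoms : Val → Val
  | .pair (.atom a) (.atom b) => if a = b then .atom 1 else .atom 0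
  | _ => .atom 0

/-- Lists, terminated by the atom `0`. -/
def list : List Val → Val
  | [] => .atom 0
  | x :: l => .pair x (list l)

open Classical in
/-- The truth value of a proposition. -/
noncomputable def truth (P : Prop) : Val := if P then .atom 1 else .atom 0

end Val

/-- Programs. Each maps a value to a value; the atom `0` counts as false in tests, every other
value as true. -/
inductive Prog
  | skip : Prog
  | const (v : Val) : Prog
  | fst : Prog
  | snd : Prog
  | isPair : Prog
  | eqAtoms : Prog
  | pair (p q : Prog) : Prog
  | seq (p q : Prog) : Prog
  | cond (c p q : Prog) : Prog
  | loop (c p : Prog) : Prog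

/-- `Runs p x y t`: on input `x` the program `p` halts with output `y` after exactly `t` steps.
Every elementary operation, and every passage through a program construct, is one step;
forming a pair does not copy its components. -/
inductive Prog.Runs : Prog → Val → Val → ℕ → Prop
  | skip {x} : Runs .skip x x 1
  | const {v x} : Runs (.const v) x v 1
  | fst {x} : Runs .fst x x.fst 1
  | snd {x} : Runs .snd x x.snd 1
  | isPair {x} : Runs .isPair x x.isPair 1
  | eqAtoms {x} : Runs .eqAtoms x x.eqAtoms 1
  | pair {p q x y z s t} : Runs p x y s → Runs q x z t → Runs (.pair p q) x (.pair y z) (s + t + 1)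
  | seq {p q x y z s t} : Runs p x y s → Runs q y z t → Runs (.seq p q) x z (s + t + 1)
  | condTrue {c p q x b y s t} : Runs c x b s → b ≠ .atom 0 → Runs p x y t →
      Runs (.cond c p q) x y (s + t + 1)
  | condFalse {c p q x y s t} : Runs c x (.atom 0) s → Runs q x y t →
      Runs (.cond c p q) x y (s + t + 1)
  | loopStop {c p x s} : Runs c x (.atom 0) s → Runs (.loop c p) x x (s + 1)
  | loopStep {c p x b y z s t u} : Runs c x b s → b ≠ .atom 0 → Runs p x y t →
      Runs (.loop c p) y z u → Runs (.loop c p) x z (s + t + u + 1)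

/-! ### Inputs and complexity -/

variable {S : Signature}

/-- The label of a DAG node and the list of pointers to its children. -/
def nodeBody (ptr : Msg S → ℕ) : Msg S → Val
  | .name a => .pair (.atom 0) (.atom a)
  | .node (.inl c) args =>
      .pair (.atom 1) (.pair (.atom c.code)
        (Val.list (List.ofFn fun i => Val.atom (ptr (args i)))))
  | .node (.inr f) args =>
      .pair (.atom 2) (.pair (.atom (S.code f))
        (Val.list (List.ofFn fun i => Val.atom (ptr (args i)))))

/-- A DAG node: its address, the tag saying whether it belongs to `Γ`, the tag saying whether it
is `M`, its label and its children. -/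
noncomputable def nodeEntry (ptr : Msg S → ℕ) (Γ : Set (Msg S)) (M T : Msg S) : Val :=
  .pair (.atom (ptr T)) (.pair (Val.truth (T ∈ Γ)) (.pair (Val.truth (T = M)) (nodeBody ptr T)))

/-- `v` is a DAG representation, with maximal sharing, of the saturated set of `Γ ∪ {M}`,
tagged with the membership in `Γ` and with the position of `M`: a list, in any order, of exactly
one node for each element of the saturated set, at pairwise different addresses. -/
def Represents (v : Val) (Γ : Set (Msg S)) (M : Msg S) : Prop :=
  ∃ (nodes : List (Msg S)) (ptr : Msg S → ℕ),
    nodes.Nodup ∧ (∀ T, T ∈ nodes ↔ T ∈ St (insert M Γ)) ∧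
    Set.InjOn ptr (St (insert M Γ)) ∧
    v = Val.list (nodes.map (nodeEntry ptr Γ M))

namespace Theory

/-- The problem of deciding `P Γ M`, for finite `Γ` and sequents in normal form, has complexity
`O(f(n))`, where `n` is the number of elements of the saturated set of `Γ ∪ {M}`. -/
def HasComplexity (E : Theory S) (P : Set (Msg S) → Msg S → Prop) (f : ℕ → ℕ) : Prop :=
  ∃ (p : Prog) (c : ℕ), ∀ (Γ : Set (Msg S)) (M : Msg S), Γ.Finite → E.NormalSequent Γ M →
    ∀ v, Represents v Γ M →
      ∃ t ≤ c * f (St (insert M Γ)).ncard, p.Runs v (Val.truth (P Γ M)) t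

/-- The problem of deciding `P Γ M` is polynomially reducible to elementary deduction: for a
constant `k`, if elementary deduction has complexity `O(f(n))`, then this problem has complexity
`O(n ^ k * f(n))`. -/
def PolyReducible (E : Theory S) (P : Set (Msg S) → Msg S → Prop) : Prop :=
  ∃ k : ℕ, ∀ f : ℕ → ℕ, Monotone f →
    E.HasComplexity E.Elementary f → E.HasComplexity P (fun n => n ^ k * f n)

end Theory

end IntruderDeduction

/-! ### Rewriting modulo AC, and freeness of the constructors modulo `E`. -/

namespace IntruderDeduction

open Relation

variable {S : Signature}

/-! ### Rewriting -/

/-! Equivalence of the systems. Soundness, from `LDer` through `SDer` to `NDer`, is an induction on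
derivations. The work is in passing from `NDer` to `LDer`. Among the sets between Γ and the finite
set `St (insert T Γ)` whose linear derivability of `T` implies that of Γ, take a maximal one, Δ
(`exists_leftClosed`). By maximality Δ is closed under all left rules. It then suffices to derive
`T` from Δ by `id` and right rules alone. For this, `Syn` closes Δ under constructors other than
`pub`, symbols of `E`, and equality. Two facts are needed: every naturally deducible message lies in
`Syn` (`LeftClosed.syn_of_nder`), and a message in `Syn` that is a subterm of `T` or of Δ is
derivable in `RDer` (`LeftClosed.rder_of_syn`).

Both rest on abstraction of alien terms. Rules and contexts contain no constructors, so an equation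
modulo `E` survives the replacement of a whole class of equal alien subterms by an arbitrary message
(`Eqv.replaceAliens`). Aliens that match nothing in Δ or in the conclusion can therefore be replaced
by anything derivable, and the remaining ones are `E`-factors, which closure under `ls` has already
put into Δ (`LeftClosed.good_of_elementary`). Replacing a class by two different names shows that an
alien term cannot arise from unrelated ones, because convergence keeps distinct names unequal
(`Convergent.consistent`). This gives freeness of the constructors and the inversion lemma
`LeftClosed.syn_alien`, from which the elimination rules follow.

Complexity. A linear derivation only meets elements of the saturated set, so deducibility of the
target is membership in an iteration that selects nodes and is stationary after as many rounds as
there are nodes (`Inst.mem_deducible_iff`, `stage_closed`). Each round runs polynomially many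
address comparisons and calls of elementary deduction. The called sequents have their saturated sets
inside the given one, since `St` is idempotent, so a nondecreasing bound for elementary deduction
applies to each call. Programs are handled by the compositional predicate `PComp`, whose exponent is
fixed before the bound `f`. Without equations, elementary deduction is syntactic and is itself such
an iteration. -/

theorem Step.mono {A B : Set (Pat S ℕ × Pat S ℕ)} (h : A ⊆ B) {M N : Msg S} (hs : Step A M N) :
    Step B M N := by
  induction hs with
  | root e he σ => exact .root e (h he) σ
  | arg g args i N _ ih => exact .arg g args i N ih

theorem eqvGen_step_update {A : Set (Pat S ℕ × Pat S ℕ)} (g : Con ⊕ S.Sym)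
    (args : Fin (S.headArity g) → Msg S) (i : Fin (S.headArity g)) {M N : Msg S}
    (h : EqvGen (Step A) M N) :
    EqvGen (Step A) (.node g (Function.update args i M)) (.node g (Function.update args i N)) := by
  induction h with
  | rel M N h =>
    have := Step.arg g (Function.update args i M) i N (by simpa using h)
    rw [Function.update_idem] at this
    exact .rel _ _ this
  | refl => exact .refl _
  | symm _ _ _ ih => exact .symm _ _ ih
  | trans _ _ _ _ _ ih₁ ih₂ => exact .trans _ _ _ ih₁ ih₂

theorem eqvGen_step_congr {A : Set (Pat S ℕ × Pat S ℕ)} (g : Con ⊕ S.Sym)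
    {args args' : Fin (S.headArity g) → Msg S} (h : ∀ i, EqvGen (Step A) (args i) (args' i)) :
    EqvGen (Step A) (.node g args) (.node g args') := by
  -- The arguments are exchanged one at a time; `s` is the set of positions already exchanged.
  have key : ∀ s : Finset (Fin (S.headArity g)),
      EqvGen (Step A) (.node g args) (.node g (s.piecewise args' args)) := by
    intro s
    induction s using Finset.induction_on with
    | empty => simpa using EqvGen.refl _
    | insert i s hi ih =>
      refine .trans _ _ _ ih ?_
      have := eqvGen_step_update g (s.piecewise args' args) i (h i)
      rw [Finset.piecewise_insert]
      convert this using 2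
      rw [← Finset.piecewise_eq_of_notMem s args' args hi, Function.update_eq_self]
  simpa using key Finset.univ

/-- Messages with the same head, `R`-related below constructors. -/
inductive SameHead (R : Msg S → Msg S → Prop) : Msg S → Msg S → Prop
  | name (a : ℕ) : SameHead R (.name a) (.name a)
  | con (c : Con) (args args' : Fin (S.headArity (.inl c)) → Msg S)
      (h : ∀ i, R (args i) (args' i)) : SameHead R (.node (.inl c) args) (.node (.inl c) args')
  | app (f f' : S.Sym) (args : Fin (S.headArity (.inr f)) → Msg S)
      (args' : Fin (S.headArity (.inr f')) → Msg S) :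
      SameHead R (.node (.inr f) args) (.node (.inr f') args')

theorem SameHead.equivalence {R : Msg S → Msg S → Prop} (hR : Equivalence R) :
    Equivalence (SameHead R) where
  refl M := by
    match M with
    | .name a => exact .name a
    | .node (.inl c) args => exact .con c _ _ fun i => hR.refl _
    | .node (.inr f) args => exact .app _ _ _ _
  symm h := by
    cases h with
    | name a => exact .name a
    | con c args args' h => exact .con c _ _ fun i => hR.symm (h i)
    | app => exact .app _ _ _ _
  trans h₁ h₂ := by
    cases h₁ with
    | name a => exact h₂
    | con c args args' h =>
      cases h₂ with
      | con _ _ args'' h' => exact .con c _ _ fun i => hR.trans (h i) (h' i)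
    | app => cases h₂; exact .app _ _ _ _

theorem Pat.subst_eq_node_inl {V : Type} {p : Pat S V} {σ : V → Msg S} {c : Con}
    {args : Fin (S.headArity (.inl c)) → Msg S} (h : p.subst σ = .node (.inl c) args) :
    ∃ x, p = .var x := by
  cases p with
  | var x => exact ⟨x, rfl⟩
  | app f a => cases h

theorem Pat.subst_eq_name {V : Type} {p : Pat S V} {σ : V → Msg S} {a : ℕ}
    (h : p.subst σ = .name a) : ∃ x, p = .var x := by
  cases p with
  | var x => exact ⟨x, rfl⟩
  | app f a => simp [Pat.subst, Msg.app] at h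

theorem Step.name_noncollapsing {A : Set (Pat S ℕ × Pat S ℕ)} (hA : ∀ e ∈ A, ∀ x, e.1 ≠ .var x)
    {a : ℕ} {N : Msg S} : ¬ Step A (.name a) N := by
  intro h
  generalize hM : Msg.name a = M at h
  cases h with
  | root e he σ => obtain ⟨x, hx⟩ := Pat.subst_eq_name hM.symm; exact hA e he x hx
  | arg => cases hM

theorem Step.con_noncollapsing {A : Set (Pat S ℕ × Pat S ℕ)} (hA : ∀ e ∈ A, ∀ x, e.1 ≠ .var x)
    {c : Con} {args : Fin (S.headArity (.inl c)) → Msg S} {N : Msg S}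
    (h : Step A (.node (.inl c) args) N) :
    ∃ i N', Step A (args i) N' ∧ N = .node (.inl c) (Function.update args i N') := by
  generalize hM : Msg.node (.inl c) args = M at h
  cases h with
  | root e he σ => obtain ⟨x, hx⟩ := Pat.subst_eq_node_inl hM.symm; exact absurd hx (hA e he x)
  | arg g args' i N h => cases hM; exact ⟨i, N, h, rfl⟩

namespace Theory

variable {E : Theory S}

theorem ACEq.equivalence : Equivalence E.ACEq := EqvGen.is_equivalence _
theorem Eqv.equivalence : Equivalence E.Eqv := EqvGen.is_equivalence _

theorem ACEq.refl (M : Msg S) : E.ACEq M M := ACEq.equivalence.refl M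
theorem ACEq.symm {M N : Msg S} (h : E.ACEq M N) : E.ACEq N M := ACEq.equivalence.symm h
theorem ACEq.trans {M N P : Msg S} (h : E.ACEq M N) (h' : E.ACEq N P) : E.ACEq M P :=
  ACEq.equivalence.trans h h'
theorem Eqv.refl (M : Msg S) : E.Eqv M M := Eqv.equivalence.refl M
theorem Eqv.symm {M N : Msg S} (h : E.Eqv M N) : E.Eqv N M := Eqv.equivalence.symm h
theorem Eqv.trans {M N P : Msg S} (h : E.Eqv M N) (h' : E.Eqv N P) : E.Eqv M P :=
  Eqv.equivalence.trans h h'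

theorem ACEq.of_step {M N : Msg S} (h : Step E.acAxioms M N) : E.ACEq M N := .rel _ _ h
theorem Eqv.of_step {M N : Msg S} (h : Step (E.rules ∪ E.acAxioms) M N) : E.Eqv M N := .rel _ _ h

theorem ACEq.congr (g : Con ⊕ S.Sym) {args args' : Fin (S.headArity g) → Msg S}
    (h : ∀ i, E.ACEq (args i) (args' i)) : E.ACEq (.node g args) (.node g args') :=
  eqvGen_step_congr g h

theorem Eqv.congr (g : Con ⊕ S.Sym) {args args' : Fin (S.headArity g) → Msg S}
    (h : ∀ i, E.Eqv (args i) (args' i)) : E.Eqv (.node g args) (.node g args') :=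
  eqvGen_step_congr g h

theorem ACEq.eqv {M N : Msg S} (h : E.ACEq M N) : E.Eqv M N :=
  EqvGen.mono (fun _ _ h => Step.mono Set.subset_union_right h) _ _ h

/-- Both sides of an AC axiom are headed by a symbol of the theory, so no root step touches a name
or a constructor. -/
theorem ACEq.sameHead {M N : Msg S} (h : E.ACEq M N) : SameHead E.ACEq M N := by
  have he := SameHead.equivalence (ACEq.equivalence (E := E))
  induction h with
  | rel M N h =>
    cases h with
    | root e h σ =>
      obtain ⟨f, -, rfl | rfl⟩ := h <;> exact .app _ _ _ _
    | arg g args i N h =>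
      cases g with
      | inl c =>
        refine .con c _ _ fun j => ?_
        rcases eq_or_ne j i with rfl | hj
        · simpa using ACEq.of_step h
        · simpa [hj] using ACEq.refl _
      | inr f => exact .app _ _ _ _
  | refl M => exact he.refl M
  | symm _ _ _ ih => exact he.symm ih
  | trans _ _ _ _ _ ih₁ ih₂ => exact he.trans ih₁ ih₂

/-- A rule whose left side is a variable would rewrite every message, including a minimal one for
the terminating relation. -/
theorem Convergent.noncollapsing (hE : E.Convergent) : ∀ e ∈ E.rules, ∀ x, e.1 ≠ .var x := by
  intro e he x hx
  obtain ⟨M, -, hM⟩ := hE.1.has_min Set.univ ⟨.name 0, trivial⟩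
  refine hM (e.2.subst fun _ => M) trivial ⟨M, _, ACEq.refl _, ?_, ACEq.refl _⟩
  have := Step.root e he (fun _ => M)
  rwa [hx] at this

theorem Rew.of_acEq_left {M M' N : Msg S} (h : E.ACEq M M') (h' : E.Rew M' N) : E.Rew M N := by
  obtain ⟨P, Q, h₁, h₂, h₃⟩ := h'
  exact ⟨P, Q, h.trans h₁, h₂, h₃⟩

theorem Rew.arg {g : Con ⊕ S.Sym} {args : Fin (S.headArity g) → Msg S} {i} {N : Msg S}
    (h : E.Rew (args i) N) : E.Rew (.node g args) (.node g (Function.update args i N)) := by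
  obtain ⟨P, Q, h₁, h₂, h₃⟩ := h
  refine ⟨.node g (Function.update args i P), .node g (Function.update args i Q), ?_, ?_, ?_⟩
  · refine ACEq.congr g fun j => ?_
    rcases eq_or_ne j i with rfl | hj
    · simpa using h₁
    · simpa [hj] using ACEq.refl _
  · have := Step.arg (A := E.rules) g (Function.update args i P) i Q (by simpa using h₂)
    rwa [Function.update_idem] at this
  · exact eqvGen_step_update g args i h₃

theorem Normal.arg {g : Con ⊕ S.Sym} {args : Fin (S.headArity g) → Msg S}
    (h : E.Normal (.node g args)) (i) : E.Normal (args i) :=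
  fun _ hN => h _ hN.arg

theorem Normal.subterm {M N : Msg S} (hN : E.Normal N) (h : M.Subterm N) : E.Normal M := by
  induction h using ReflTransGen.head_induction_on with
  | refl => exact hN
  | head h _ ih =>
    obtain ⟨g, args, i, rfl, rfl⟩ := h
    exact ih.arg i

theorem Normal.name (hE : E.Convergent) (a : ℕ) : E.Normal (.name a) := by
  rintro N ⟨P, Q, h₁, h₂, -⟩
  cases h₁.sameHead
  exact Step.name_noncollapsing hE.noncollapsing h₂

theorem Normal.con (hE : E.Convergent) {c : Con} {args : Fin (S.headArity (.inl c)) → Msg S}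
    (h : ∀ i, E.Normal (args i)) : E.Normal (.node (.inl c) args) := by
  rintro N ⟨P, Q, h₁, h₂, -⟩
  cases h₁.sameHead with
  | con _ _ args' h' =>
    obtain ⟨i, N', hs, -⟩ := h₂.con_noncollapsing hE.noncollapsing
    exact h i N' ⟨_, _, h' i, hs, ACEq.refl _⟩

theorem Convergent.rew_con (hE : E.Convergent) {c : Con}
    {args : Fin (S.headArity (.inl c)) → Msg S} {N : Msg S}
    (h : ReflTransGen E.Rew (.node (.inl c) args) N) : ∃ args', N = .node (.inl c) args' := by
  induction h with
  | refl => exact ⟨_, rfl⟩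
  | tail _ h ih =>
    obtain ⟨args', rfl⟩ := ih
    obtain ⟨P, Q, h₁, h₂, h₃⟩ := h
    cases h₁.sameHead with
    | con _ _ args' h' =>
      obtain ⟨i, N', hs, rfl⟩ := h₂.con_noncollapsing hE.noncollapsing
      cases h₃.sameHead with
      | con _ _ args' h' => exact ⟨_, rfl⟩

/-- A rewrite step already begins with an AC conversion, which absorbs the given one; only a
reduction of length zero leaves it at the end. -/
theorem rew_of_acEq {M N P : Msg S} (h : E.ACEq M N) (h' : ReflTransGen E.Rew N P) :
    ∃ Q, ReflTransGen E.Rew M Q ∧ E.ACEq Q P := by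
  cases h'.cases_head with
  | inl h' => subst h'; exact ⟨M, .refl, h⟩
  | inr h' =>
    obtain ⟨Q, h₁, h₂⟩ := h'
    exact ⟨P, .head (h₁.of_acEq_left h) h₂, ACEq.refl _⟩

/-- The Church–Rosser property modulo AC. -/
theorem Convergent.churchRosser (hE : E.Convergent) {M N : Msg S} (h : E.Eqv M N) :
    ∃ P Q, ReflTransGen E.Rew M P ∧ ReflTransGen E.Rew N Q ∧ E.ACEq P Q := by
  induction h with
  | rel M N h =>
    have key : E.Rew M N ∨ E.ACEq M N := by
      induction h with
      | root e he σ =>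
        rcases he with he | he
        · exact .inl ⟨_, _, ACEq.refl _, .root e he σ, ACEq.refl _⟩
        · exact .inr (.rel _ _ (.root e he σ))
      | arg g args i N _ ih =>
        rcases ih with ih | ih
        · exact .inl ih.arg
        · refine .inr (ACEq.congr g fun j => ?_)
          rcases eq_or_ne j i with rfl | hj
          · simpa using ih
          · simpa [hj] using ACEq.refl _
    rcases key with h | h
    · exact ⟨N, N, .single h, .refl, ACEq.refl _⟩
    · exact ⟨M, N, .refl, .refl, h⟩
  | refl M => exact ⟨M, M, .refl, .refl, ACEq.refl _⟩
  | symm _ _ _ ih => obtain ⟨P, Q, h₁, h₂, h₃⟩ := ih; exact ⟨Q, P, h₂, h₁, h₃.symm⟩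
  | trans _ _ _ _ _ ih₁ ih₂ =>
    obtain ⟨P₁, P₂, h₁, h₂, h₃⟩ := ih₁
    obtain ⟨P₃, P₄, h₄, h₅, h₆⟩ := ih₂
    -- Confluence closes the peak at the middle term; `rew_of_acEq` then carries the two new
    -- reductions across the outer AC equalities.
    obtain ⟨Q₁, Q₂, h₇, h₈, h₉⟩ := hE.2 _ _ _ h₂ h₄
    obtain ⟨R₁, k₁, k₂⟩ := rew_of_acEq h₃ h₇
    obtain ⟨R₂, k₃, k₄⟩ := rew_of_acEq h₆.symm h₈
    exact ⟨R₁, R₂, h₁.trans k₁, h₅.trans k₃, k₂.trans (h₉.trans k₄.symm)⟩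

theorem Normal.eq_of_rew {M N : Msg S} (h : E.Normal M) (h' : ReflTransGen E.Rew M N) : N = M := by
  cases h'.cases_head with
  | inl h' => exact h'.symm
  | inr h' => obtain ⟨Q, h₁, -⟩ := h'; exact absurd h₁ (h Q)

theorem Convergent.acEq_of_eqv (hE : E.Convergent) {M N : Msg S} (hM : E.Normal M)
    (hN : E.Normal N) (h : E.Eqv M N) : E.ACEq M N := by
  obtain ⟨P, Q, h₁, h₂, h₃⟩ := hE.churchRosser h
  rwa [hM.eq_of_rew h₁, hN.eq_of_rew h₂] at h₃

theorem Convergent.consistent (hE : E.Convergent) : ¬ E.Eqv (.name 0) (.name 1) := by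
  intro h
  cases (hE.acEq_of_eqv (Normal.name hE 0) (Normal.name hE 1) h).sameHead

theorem Convergent.con_of_eqv (hE : E.Convergent) {M : Msg S} (hM : E.Normal M) {c : Con}
    {args : Fin (S.headArity (.inl c)) → Msg S} (h : E.Eqv M (.node (.inl c) args)) :
    ∃ args', M = .node (.inl c) args' := by
  obtain ⟨P, Q, h₁, h₂, h₃⟩ := hE.churchRosser h
  obtain ⟨args', rfl⟩ := hE.rew_con h₂
  rw [hM.eq_of_rew h₁] at h₃
  cases h₃.sameHead with
  | con _ args' => exact ⟨_, rfl⟩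

end Theory

/-! ### Abstraction of alien terms -/

open Classical in
/-- One layer of `Msg.replaceAliens`: `args'` are the arguments after replacement. -/
noncomputable def Msg.replaceAliensNode (P : Set (Msg S)) (w : Msg S) :
    (g : Con ⊕ S.Sym) → (args args' : Fin (S.headArity g) → Msg S) → Msg S
  | .inl c, args, _ => if .node (.inl c) args ∈ P then w else .node (.inl c) args
  | .inr f, _, args' => .node (.inr f) args'

/-- Replace the maximal alien subterms that belong to `P` by `w`. -/
noncomputable def Msg.replaceAliens (P : Set (Msg S)) (w : Msg S) : Msg S → Msg S
  | .name a => .name a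
  | .node g args => replaceAliensNode P w g args fun i => Msg.replaceAliens P w (args i)

/-- `A` is a maximal alien subterm of a message. -/
inductive Msg.MaxAlien (A : Msg S) : Msg S → Prop
  | self : A.Alien → MaxAlien A A
  | app (f : S.Sym) (args : Fin (S.headArity (.inr f)) → Msg S) (i) :
      MaxAlien A (args i) → MaxAlien A (.node (.inr f) args)

theorem Msg.MaxAlien.alien {A M : Msg S} (h : A.MaxAlien M) : A.Alien := by
  induction h with
  | self h => exact h
  | app _ _ _ _ ih => exact ih

theorem Msg.IsFactor.subterm_trans {A M N : Msg S} (h : A.IsFactor M) (h' : M.Subterm N) :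
    A.IsFactor N := by
  obtain ⟨hA, F, h₁, h₂⟩ := h
  exact ⟨hA, F, h₁.trans h', h₂⟩

theorem Msg.MaxAlien.eq_or_isFactor {A M : Msg S} (h : A.MaxAlien M) : A = M ∨ A.IsFactor M := by
  induction h with
  | self => exact .inl rfl
  | app f args i h ih =>
    right
    rcases ih with ih | ih
    · exact ⟨h.alien, _, .refl, ⟨f, args, rfl⟩, _, args, i, rfl, ih⟩
    · exact ih.subterm_trans (.single ⟨_, args, i, rfl, rfl⟩)

theorem Msg.MaxAlien.subterm {A M : Msg S} (h : A.MaxAlien M) : A.Subterm M := by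
  induction h with
  | self => exact .refl
  | app f args i h ih => exact ih.tail ⟨_, args, i, rfl, rfl⟩

/-- Patterns contain no constructors, so every alien subterm of an instance sits inside the
substituted messages. -/
theorem Msg.replaceAliens_subst (P : Set (Msg S)) (w : Msg S) {V : Type} (σ : V → Msg S)
    (p : Pat S V) :
    Msg.replaceAliens P w (p.subst σ) = p.subst fun x => Msg.replaceAliens P w (σ x) := by
  induction p with
  | var x => rfl
  | app f args ih =>
    simp only [Pat.subst, Msg.app, Msg.replaceAliens, Msg.replaceAliensNode]
    congr 1
    exact funext ih

theorem Msg.replaceAliens_of_mem {P : Set (Msg S)} {w M : Msg S} (hM : M.Alien) (h : M ∈ P) :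
    Msg.replaceAliens P w M = w := by
  obtain ⟨c, args, rfl⟩ := hM
  simp [Msg.replaceAliens, Msg.replaceAliensNode, h]

theorem Msg.replaceAliens_eq_self {P : Set (Msg S)} {w M : Msg S}
    (h : ∀ A : Msg S, A.MaxAlien M → A ∉ P) : Msg.replaceAliens P w M = M := by
  induction M with
  | name a => rfl
  | node g args ih =>
    cases g with
    | inl c => simp [Msg.replaceAliens, Msg.replaceAliensNode, h _ (.self ⟨c, args, rfl⟩)]
    | inr f =>
      simp only [Msg.replaceAliens, Msg.replaceAliensNode]
      congr 1
      exact funext fun i => ih i fun A hA => h A (.app f args i hA)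

namespace Theory

variable {E : Theory S}

/-- Membership in `P` of alien terms is invariant under equality below the constructor. -/
def AlienStable (E : Theory S) (P : Set (Msg S)) : Prop :=
  ∀ M N, SameHead E.Eqv M N → M.Alien → M ∈ P → N ∈ P

/-- A root step commutes with replacement because patterns have no aliens. A step inside an alien
term stays within its class, so by stability both sides are replaced or neither is. -/
theorem Eqv.replaceAliens {P : Set (Msg S)} (hP : E.AlienStable P) (w : Msg S) {M N : Msg S}
    (h : E.Eqv M N) : E.Eqv (Msg.replaceAliens P w M) (Msg.replaceAliens P w N) := by
  induction h with
  | rel M N h =>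
    induction h with
    | root e he σ =>
      rw [Msg.replaceAliens_subst, Msg.replaceAliens_subst]
      exact .rel _ _ (.root e he _)
    | arg g args i N h ih =>
      cases g with
      | inl c =>
        have hs : SameHead E.Eqv (.node (.inl c) args)
            (.node (.inl c) (Function.update args i N)) := by
          refine .con c _ _ fun j => ?_
          rcases eq_or_ne j i with rfl | hj
          · simpa using Eqv.of_step h
          · simpa [hj] using Eqv.refl _
        have hiff : Msg.node (.inl c) args ∈ P ↔
            Msg.node (.inl c) (Function.update args i N) ∈ P :=
          ⟨hP _ _ hs ⟨c, _, rfl⟩,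
            hP _ _ ((SameHead.equivalence Eqv.equivalence).symm hs) ⟨c, _, rfl⟩⟩
        by_cases hm : Msg.node (.inl c) args ∈ P
        · simpa [Msg.replaceAliens, Msg.replaceAliensNode, hm, hiff.1 hm] using Eqv.refl w
        · simpa [Msg.replaceAliens, Msg.replaceAliensNode, hm, mt hiff.2 hm] using
            Eqv.of_step (Step.arg _ args i N h)
      | inr f =>
        refine Eqv.congr (.inr f) fun j => ?_
        rcases eq_or_ne j i with rfl | hj
        · simpa using ih
        · simpa [hj] using Eqv.refl _
  | refl M => exact Eqv.refl _
  | symm _ _ _ ih => exact ih.symm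
  | trans _ _ _ _ _ ih₁ ih₂ => exact ih₁.trans ih₂

theorem AlienStable.setOf_sameHead (M : Msg S) : E.AlienStable {N | SameHead E.Eqv M N} :=
  fun _ _ h _ h' => (SameHead.equivalence Eqv.equivalence).trans h' h

theorem Convergent.not_forall_eqv (hE : E.Convergent) (M : Msg S) : ¬ ∀ w, E.Eqv M w :=
  fun h => hE.consistent ((h _).symm.trans (h _))

/-- Constructors are free and injective modulo the theory. -/
theorem Convergent.sameHead_of_eqv (hE : E.Convergent) {M N : Msg S} (hM : M.Alien)
    (hN : N.Alien) (h : E.Eqv M N) : SameHead E.Eqv M N := by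
  -- If the heads disagree, replacing the class of `M` by `w` sends `M` to `w` and leaves `N` alone,
  -- for every `w`; this contradicts consistency.
  by_contra hs
  refine hE.not_forall_eqv N fun w => ?_
  have := h.replaceAliens (AlienStable.setOf_sameHead M) w
  rw [Msg.replaceAliens_of_mem (P := {N | SameHead E.Eqv M N}) hM
      ((SameHead.equivalence Eqv.equivalence).refl M),
    Msg.replaceAliens_eq_self] at this
  · exact this.symm
  · intro A hA
    obtain ⟨c, args, rfl⟩ := hN
    cases hA
    exact hs

end Theory

end IntruderDeduction

/-! ### Saturated sets, and completeness of the linear system. -/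

namespace IntruderDeduction

open Relation

variable {S : Signature}

/-! ### Subterms and saturated sets -/

theorem Msg.imm_wellFounded : WellFounded (Msg.Imm (S := S)) := by
  refine ⟨fun M => ?_⟩
  induction M with
  | name a => exact ⟨_, fun N h => by obtain ⟨g, args, i, h, -⟩ := h; cases h⟩
  | node g args ih =>
    refine ⟨_, fun N h => ?_⟩
    obtain ⟨g', args', i, h, rfl⟩ := h
    cases h
    exact ih i

theorem Msg.properSubterm_iff {M N : Msg S} : M.ProperSubterm N ↔ TransGen Msg.Imm M N := by
  refine ⟨fun h => ?_, fun h => ⟨h.to_reflTransGen, ?_⟩⟩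
  · rcases (reflTransGen_iff_eq_or_transGen.1 h.1) with h' | h'
    · exact absurd h'.symm h.2
    · exact h'
  · rintro rfl
    exact (Msg.imm_wellFounded (S := S)).transGen.irrefl.irrefl _ h

theorem mem_pst_iff {Γ : Set (Msg S)} {M : Msg S} :
    M ∈ pst Γ ↔ ∃ N ∈ Γ, TransGen Msg.Imm M N := by
  simp [pst, Msg.properSubterm_iff]

theorem imm_node {g : Con ⊕ S.Sym} (args : Fin (S.headArity g) → Msg S) (i) :
    Msg.Imm (args i) (.node g args) := ⟨g, args, i, rfl, rfl⟩

/-- The added signatures have components that are already proper subterms, so they contribute no new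
ones. This makes `St` idempotent, as used in `St_subset`. -/
theorem mem_pst_of_imm {Γ : Set (Msg S)} {M N : Msg S} (hN : N ∈ St Γ) (h : M.Imm N) :
    M ∈ pst Γ := by
  rcases hN with (hN | hN) | hN
  · exact mem_pst_iff.2 ⟨N, hN, .single h⟩
  · obtain ⟨P, hP, hN⟩ := mem_pst_iff.1 hN
    exact mem_pst_iff.2 ⟨P, hP, .head h hN⟩
  · obtain ⟨A, hA, B, hB, rfl⟩ := hN
    obtain ⟨g, args, i, h, rfl⟩ := h
    cases h
    change Fin 2 at i
    fin_cases i
    · exact hA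
    · exact hB

theorem pst_subset_St (Γ : Set (Msg S)) : pst Γ ⊆ St Γ := fun _ h => .inl (.inr h)
theorem subset_St (Γ : Set (Msg S)) : Γ ⊆ St Γ := fun _ h => .inl (.inl h)

theorem mem_pst_of_transGen {Γ : Set (Msg S)} {M N : Msg S} (hN : N ∈ St Γ)
    (h : TransGen Msg.Imm M N) : M ∈ pst Γ := by
  induction h using TransGen.head_induction_on with
  | single h => exact mem_pst_of_imm hN h
  | head h _ ih => exact mem_pst_of_imm (pst_subset_St _ ih) h

theorem pst_subset {Γ Δ : Set (Msg S)} (h : Δ ⊆ St Γ) : pst Δ ⊆ pst Γ := by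
  intro M hM
  obtain ⟨N, hN, hMN⟩ := mem_pst_iff.1 hM
  exact mem_pst_of_transGen (h hN) hMN

theorem sign_mem_St {Γ : Set (Msg S)} {M N : Msg S} (hM : M ∈ pst Γ) (hN : N ∈ pst Γ) :
    .sign M N ∈ St Γ := .inr ⟨M, hM, N, hN, rfl⟩

theorem St_subset {Γ Δ : Set (Msg S)} (h : Δ ⊆ St Γ) : St Δ ⊆ St Γ := by
  rintro M ((hM | hM) | ⟨A, hA, B, hB, rfl⟩)
  · exact h hM
  · exact pst_subset_St _ (pst_subset h hM)
  · exact sign_mem_St (pst_subset h hA) (pst_subset h hB)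

theorem Msg.subterms_finite (N : Msg S) : {M : Msg S | M.Subterm N}.Finite := by
  induction N with
  | name a =>
    refine (Set.finite_singleton (Msg.name a)).subset fun M h => ?_
    rcases ReflTransGen.cases_tail h with h | ⟨P, -, g, args, i, h, -⟩
    · exact h.symm
    · cases h
  | node g args ih =>
    refine ((Set.finite_singleton (Msg.node g args)).union (Set.finite_iUnion ih)).subset
      fun M h => ?_
    rcases ReflTransGen.cases_tail h with h | ⟨P, hP, g, args, i, h, rfl⟩
    · exact .inl h.symm
    · cases h
      exact .inr (Set.mem_iUnion.2 ⟨i, hP⟩)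

theorem pst_finite {Γ : Set (Msg S)} (h : Γ.Finite) : (pst Γ).Finite :=
  (h.biUnion fun N _ => Msg.subterms_finite N).subset fun _ ⟨_, hN, hM⟩ =>
    Set.mem_biUnion hN hM.1

theorem St_finite {Γ : Set (Msg S)} (h : Γ.Finite) : (St Γ).Finite := by
  refine (h.union (pst_finite h)).union ?_
  refine ((pst_finite h).image2 Msg.sign (pst_finite h)).subset ?_
  rintro _ ⟨A, hA, B, hB, rfl⟩
  exact ⟨A, hA, B, hB, rfl⟩

theorem mem_pst_of_factorOf {Γ Δ : Set (Msg S)} {A : Msg S} (h : Δ ⊆ St Γ)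
    (hA : FactorOf A Δ) : A ∈ pst Γ := by
  obtain ⟨N, hN, -, F, hF, -, hA⟩ := hA
  exact mem_pst_of_transGen (h hN) (TransGen.head' hA hF)

/-- A tuple is not definitionally the vector of its entries, but the lists of their values are equal
by `rfl`. The same device serves the other constructors. -/
theorem Msg.node_pair (args : Fin 2 → Msg S) :
    .node (.inl .pair) args = Msg.pair (args 0) (args 1) :=
  congrArg (Msg.node (.inl .pair)) (List.ofFn_inj.1 rfl)
theorem Msg.node_enc (args : Fin 2 → Msg S) :
    .node (.inl .enc) args = Msg.enc (args 0) (args 1) :=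
  congrArg (Msg.node (.inl .enc)) (List.ofFn_inj.1 rfl)
theorem Msg.node_sign (args : Fin 2 → Msg S) :
    .node (.inl .sign) args = Msg.sign (args 0) (args 1) :=
  congrArg (Msg.node (.inl .sign)) (List.ofFn_inj.1 rfl)
theorem Msg.node_blind (args : Fin 2 → Msg S) :
    .node (.inl .blind) args = Msg.blind (args 0) (args 1) :=
  congrArg (Msg.node (.inl .blind)) (List.ofFn_inj.1 rfl)
theorem Msg.node_pub (args : Fin 1 → Msg S) :
    .node (.inl .pub) args = Msg.pub (args 0) :=
  congrArg (Msg.node (.inl .pub)) (List.ofFn_inj.1 rfl)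

theorem Msg.imm_pair_left (M N : Msg S) :
    M.Imm (.pair M N) := imm_node (g := .inl .pair) _ (0 : Fin 2)
theorem Msg.imm_pair_right (M N : Msg S) :
    N.Imm (.pair M N) := imm_node (g := .inl .pair) _ (1 : Fin 2)
theorem Msg.imm_enc_left (M N : Msg S) :
    M.Imm (.enc M N) := imm_node (g := .inl .enc) _ (0 : Fin 2)
theorem Msg.imm_enc_right (M N : Msg S) :
    N.Imm (.enc M N) := imm_node (g := .inl .enc) _ (1 : Fin 2)
theorem Msg.imm_sign_left (M N : Msg S) :
    M.Imm (.sign M N) := imm_node (g := .inl .sign) _ (0 : Fin 2)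
theorem Msg.imm_sign_right (M N : Msg S) :
    N.Imm (.sign M N) := imm_node (g := .inl .sign) _ (1 : Fin 2)
theorem Msg.imm_blind_left (M N : Msg S) :
    M.Imm (.blind M N) :=
  imm_node (g := .inl .blind) _ (0 : Fin 2)
theorem Msg.imm_blind_right (M N : Msg S) :
    N.Imm (.blind M N) :=
  imm_node (g := .inl .blind) _ (1 : Fin 2)
theorem Msg.imm_pub (M : Msg S) :
    M.Imm (.pub M) := imm_node (g := .inl .pub) _ (0 : Fin 1)

section SameHead

variable {R : Msg S → Msg S → Prop}

theorem SameHead.of_con {c : Con} {args : Fin (S.headArity (.inl c)) → Msg S} {A : Msg S}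
    (h : SameHead R (.node (.inl c) args) A) :
    ∃ args', A = .node (.inl c) args' ∧ ∀ i, R (args i) (args' i) := by
  cases h with
  | con _ _ args' h => exact ⟨args', rfl, h⟩

theorem SameHead.of_pair {M N A : Msg S} (h : SameHead R (.pair M N) A) :
    ∃ M' N', A = .pair M' N' ∧ R M M' ∧ R N N' := by
  obtain ⟨args', rfl, h'⟩ := SameHead.of_con h
  exact ⟨_, _, Msg.node_pair args', h' (0 : Fin 2), h' (1 : Fin 2)⟩

theorem SameHead.of_enc {M N A : Msg S} (h : SameHead R (.enc M N) A) :
    ∃ M' N', A = .enc M' N' ∧ R M M' ∧ R N N' := by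
  obtain ⟨args', rfl, h'⟩ := SameHead.of_con h
  exact ⟨_, _, Msg.node_enc args', h' (0 : Fin 2), h' (1 : Fin 2)⟩

theorem SameHead.of_sign {M N A : Msg S} (h : SameHead R (.sign M N) A) :
    ∃ M' N', A = .sign M' N' ∧ R M M' ∧ R N N' := by
  obtain ⟨args', rfl, h'⟩ := SameHead.of_con h
  exact ⟨_, _, Msg.node_sign args', h' (0 : Fin 2), h' (1 : Fin 2)⟩

theorem SameHead.of_blind {M N A : Msg S} (h : SameHead R (.blind M N) A) :
    ∃ M' N', A = .blind M' N' ∧ R M M' ∧ R N N' := by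
  obtain ⟨args', rfl, h'⟩ := SameHead.of_con h
  exact ⟨_, _, Msg.node_blind args', h' (0 : Fin 2), h' (1 : Fin 2)⟩

theorem SameHead.of_pub {M A : Msg S} (h : SameHead R (.pub M) A) :
    ∃ M', A = .pub M' ∧ R M M' := by
  obtain ⟨args', rfl, h'⟩ := SameHead.of_con h
  exact ⟨_, Msg.node_pub args', h' (0 : Fin 1)⟩

end SameHead

namespace Theory

variable {E : Theory S}

theorem SameHead.eqv {A B : Msg S} (h : SameHead E.Eqv A B) (hA : A.Alien) : E.Eqv A B := by
  obtain ⟨c, args, rfl⟩ := hA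
  obtain ⟨args', rfl, h'⟩ := SameHead.of_con h
  exact Eqv.congr _ h'

theorem Normal.of_mem_pst {Γ : Set (Msg S)} (h : ∀ N ∈ Γ, E.Normal N) {M : Msg S}
    (hM : M ∈ pst Γ) : E.Normal M := by
  obtain ⟨N, hN, hM⟩ := hM
  exact (h N hN).subterm hM.1

theorem Normal.of_mem_St (hE : E.Convergent) {Γ : Set (Msg S)} (h : ∀ N ∈ Γ, E.Normal N)
    {M : Msg S} (hM : M ∈ St Γ) : E.Normal M := by
  rcases hM with (hM | hM) | ⟨A, hA, B, hB, rfl⟩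
  · exact h M hM
  · exact Normal.of_mem_pst h hM
  · refine Normal.con hE fun i => ?_
    change Fin 2 at i
    fin_cases i
    · exact Normal.of_mem_pst h hA
    · exact Normal.of_mem_pst h hB

/-! ### Elementary deduction -/

theorem Elementary.mem {Γ : Set (Msg S)} {M : Msg S} (h : M ∈ Γ) : E.Elementary Γ M :=
  ⟨1, .var 0, fun _ => M, fun _ => h, Eqv.refl _⟩

theorem Elementary.conv {Γ : Set (Msg S)} {M N : Msg S} (h : E.Elementary Γ N) (h' : E.Eqv N M) :
    E.Elementary Γ M := by
  obtain ⟨k, C, Ms, h₁, h₂⟩ := h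
  exact ⟨k, C, Ms, h₁, h₂.trans h'⟩

end Theory

/-- Rename the variables of a term. -/
def Pat.rename {V W : Type} (r : V → W) : Pat S V → Pat S W
  | .var x => .var (r x)
  | .app f args => .app f fun i => (args i).rename r

theorem Pat.subst_rename {V W : Type} (r : V → W) (σ : W → Msg S) (p : Pat S V) :
    (p.rename r).subst σ = p.subst (σ ∘ r) := by
  induction p with
  | var x => rfl
  | app f args ih => simp only [Pat.rename, Pat.subst, ih]

namespace Theory

variable {E : Theory S}

theorem Elementary.app {Γ : Set (Msg S)} {f : S.Sym} {args : Fin (S.arity f) → Msg S}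
    (h : ∀ i, E.Elementary Γ (args i)) : E.Elementary Γ (.app f args) := by
  choose k C Ms h₁ h₂ using h
  -- The holes of the combined context are the disjoint union of the holes of the arguments'
  -- contexts.
  refine ⟨∑ i, k i, .app f fun i => (C i).rename fun j => finSigmaFinEquiv ⟨i, j⟩,
    fun j => Ms (finSigmaFinEquiv.symm j).1 (finSigmaFinEquiv.symm j).2, fun j => h₁ _ _, ?_⟩
  refine Eqv.congr (.inr f) fun i => ?_
  rw [Pat.subst_rename]
  convert h₂ i using 2
  funext j
  exact congrArg (fun x : (i : Fin (S.arity f)) × Fin (k i) => Ms x.1 x.2)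
    (finSigmaFinEquiv.symm_apply_apply ⟨i, j⟩)

theorem Elementary.induction {Γ : Set (Msg S)} {motive : Msg S → Prop}
    (mem : ∀ M ∈ Γ, motive M)
    (app : ∀ f (args : Fin (S.arity f) → Msg S), (∀ i, motive (args i)) → motive (.app f args))
    (conv : ∀ M N, E.Eqv M N → motive M → motive N) {M : Msg S} (h : E.Elementary Γ M) :
    motive M := by
  obtain ⟨k, C, Ms, h₁, h₂⟩ := h
  refine conv _ _ h₂ ?_
  clear h₂
  induction C with
  | var x => exact mem _ (h₁ x)
  | app f args ih => exact app f _ ih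

theorem Elementary.trans {Γ Δ : Set (Msg S)} (h : ∀ M ∈ Δ, E.Elementary Γ M) {M : Msg S}
    (hM : E.Elementary Δ M) : E.Elementary Γ M :=
  hM.induction h (fun _ _ => Elementary.app) fun _ _ h h' => h'.conv h

theorem Elementary.mono {Γ Δ : Set (Msg S)} (h : Δ ⊆ Γ) {M : Msg S}
    (hM : E.Elementary Δ M) : E.Elementary Γ M :=
  hM.trans fun _ h' => .mem (h h')

theorem Elementary.replaceAliens {P : Set (Msg S)} (hP : E.AlienStable P) (w : Msg S)
    {Γ : Set (Msg S)} {M : Msg S} (h : E.Elementary Γ M) :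
    E.Elementary (Msg.replaceAliens P w '' Γ) (Msg.replaceAliens P w M) := by
  obtain ⟨k, C, Ms, h₁, h₂⟩ := h
  refine ⟨k, C, fun i => Msg.replaceAliens P w (Ms i), fun i => ⟨_, h₁ i, rfl⟩, ?_⟩
  rw [← Msg.replaceAliens_subst]
  exact h₂.replaceAliens hP w

/-! ### Soundness -/

theorem RDer.con {Γ : Set (Msg S)} {c : Con} (hc : c ≠ .pub)
    {args : Fin (S.headArity (.inl c)) → Msg S} (h : ∀ i, E.RDer Γ (args i)) :
    E.RDer Γ (.node (.inl c) args) := by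
  cases c with
  | pub => exact absurd rfl hc
  | sign => exact (Msg.node_sign args).symm ▸ .signR (h (0 : Fin 2)) (h (1 : Fin 2))
  | blind => exact (Msg.node_blind args).symm ▸ .blindR (h (0 : Fin 2)) (h (1 : Fin 2))
  | pair => exact (Msg.node_pair args).symm ▸ .pairR (h (0 : Fin 2)) (h (1 : Fin 2))
  | enc => exact (Msg.node_enc args).symm ▸ .encR (h (0 : Fin 2)) (h (1 : Fin 2))

theorem Elementary.nder {Γ : Set (Msg S)} {M : Msg S} (h : E.Elementary Γ M) : E.NDer Γ M :=
  h.induction (fun _ => .id) (fun _ _ => .appI) fun _ _ h h' => .conv h.symm h'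

theorem NDer.trans {Γ Δ : Set (Msg S)} (h : ∀ N ∈ Δ, E.NDer Γ N) {M : Msg S}
    (hM : E.NDer Δ M) : E.NDer Γ M := by
  induction hM with
  | id h' => exact h _ h'
  | encE _ _ h₁ h₂ => exact .encE h₁ h₂
  | encI _ _ h₁ h₂ => exact .encI h₁ h₂
  | pairE₁ _ h₁ => exact .pairE₁ h₁
  | pairE₂ _ h₁ => exact .pairE₂ h₁
  | pairI _ _ h₁ h₂ => exact .pairI h₁ h₂
  | signE _ _ h₁ h₂ => exact .signE h₁ h₂
  | signI _ _ h₁ h₂ => exact .signI h₁ h₂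
  | blindE₁ _ _ h₁ h₂ => exact .blindE₁ h₁ h₂
  | blindI _ _ h₁ h₂ => exact .blindI h₁ h₂
  | blindE₂ _ _ h₁ h₂ => exact .blindE₂ h₁ h₂
  | appI _ h => exact .appI h
  | conv h' _ h => exact .conv h' h

theorem NDer.cut {Γ : Set (Msg S)} {A M : Msg S} (hA : E.NDer Γ A)
    (hM : E.NDer (insert A Γ) M) : E.NDer Γ M :=
  hM.trans fun N hN => by
    rcases hN with rfl | hN
    · exact hA
    · exact .id hN

theorem NDer.cut₂ {Γ : Set (Msg S)} {A B M : Msg S} (hA : E.NDer Γ A) (hB : E.NDer Γ B)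
    (hM : E.NDer (insert A (insert B Γ)) M) : E.NDer Γ M :=
  hM.trans fun N hN => by
    rcases hN with rfl | rfl | hN
    · exact hA
    · exact hB
    · exact .id hN

theorem SDer.nder {Γ : Set (Msg S)} {M : Msg S} (h : E.SDer Γ M) : E.NDer Γ M := by
  induction h with
  | id h => exact h.nder
  | cut _ _ _ h₁ h₂ => exact h₁.cut h₂
  | pairL h _ h₁ => exact .cut₂ (.pairE₁ (.id h)) (.pairE₂ (.id h)) h₁
  | pairR _ _ h₁ h₂ => exact .pairI h₁ h₂
  | encL h _ _ h₁ h₂ => exact .cut₂ (.encE (.id h) h₁) h₁ h₂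
  | encR _ _ h₁ h₂ => exact .encI h₁ h₂
  | signL h h' hKL _ h₁ =>
    exact .cut (.signE (.id h) (.conv (Eqv.congr (.inl .pub) (fun i => by
      change Fin 1 at i; fin_cases i; exact hKL.eqv)) (.id h'))) h₁
  | signR _ _ h₁ h₂ => exact .signI h₁ h₂
  | blindL₁ h _ _ h₁ h₂ => exact .cut₂ (.blindE₁ (.id h) h₁) h₁ h₂
  | blindR _ _ h₁ h₂ => exact .blindI h₁ h₂
  | blindL₂ h _ _ h₁ h₂ => exact .cut₂ (.blindE₂ (.id h) h₁) h₁ h₂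
  | acut _ _ _ h₁ h₂ => exact h₁.cut h₂

theorem RDer.sder {Γ : Set (Msg S)} {M : Msg S} (h : E.RDer Γ M) : E.SDer Γ M := by
  induction h with
  | id h => exact .id h
  | pairR _ _ h₁ h₂ => exact .pairR h₁ h₂
  | encR _ _ h₁ h₂ => exact .encR h₁ h₂
  | signR _ _ h₁ h₂ => exact .signR h₁ h₂
  | blindR _ _ h₁ h₂ => exact .blindR h₁ h₂

theorem LDer.sder {Γ : Set (Msg S)} {M : Msg S} (h : E.LDer Γ M) : E.SDer Γ M := by
  induction h with
  | r h => exact h.sder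
  | le h hK _ ih => exact .encL h hK.sder ih
  | lp h _ ih => exact .pairL h ih
  | sign h h' hKL _ ih => exact .signL h h' hKL ih
  | blind₁ h hK _ ih => exact .blindL₁ h hK.sder ih
  | blind₂ h hK _ ih => exact .blindL₂ h hK.sder ih
  | ls h hA _ ih => exact .acut h hA.sder ih

/-! ### Completeness of the linear system -/

/-- `Δ` is closed under the left rules of `𝓛`, for the target `T`. -/
structure LeftClosed (E : Theory S) (Δ : Set (Msg S)) (T : Msg S) : Prop where
  pair : ∀ M N, .pair M N ∈ Δ → M ∈ Δ ∧ N ∈ Δ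
  enc : ∀ M K, .enc M K ∈ Δ → E.RDer Δ K → M ∈ Δ
  sign : ∀ M K L, .sign M K ∈ Δ → .pub L ∈ Δ → E.ACEq K L → M ∈ Δ
  blind : ∀ M K, .blind M K ∈ Δ → E.RDer Δ K → M ∈ Δ
  unblind : ∀ M R K, .sign (.blind M R) K ∈ Δ → E.RDer Δ R → .sign M K ∈ Δ
  factor : ∀ A, FactorOf A (insert T Δ) → E.RDer Δ A → A ∈ Δ

/-- Take Δ maximal among the subsets of the saturated set whose linear derivability of `T` transfers
to Γ. A left rule applied to Δ gives a larger set of the same kind, so its new formulas are already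
in Δ. -/
theorem exists_leftClosed {Γ : Set (Msg S)} (hΓ : Γ.Finite) (T : Msg S) :
    ∃ Δ, Γ ⊆ Δ ∧ Δ ⊆ St (insert T Γ) ∧ (E.LDer Δ T → E.LDer Γ T) ∧ LeftClosed E Δ T := by
  set U := St (insert T Γ) with hU
  have hfin : U.Finite := St_finite (hΓ.insert T)
  have hΓU : Γ ⊆ U := (Set.subset_insert _ _).trans (subset_St _)
  have hTU : T ∈ U := subset_St _ (Set.mem_insert _ _)
  obtain ⟨Δ, hmax⟩ := Set.Finite.exists_maximal
    (s := {Δ : Set (Msg S) | Γ ⊆ Δ ∧ Δ ⊆ U ∧ (E.LDer Δ T → E.LDer Γ T)})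
    (hfin.finite_subsets.subset fun Δ h => h.2.1) ⟨Γ, subset_rfl, hΓU, id⟩
  obtain ⟨h₁, h₂, h₃⟩ := hmax.prop
  have key : ∀ Δ', Δ ⊆ Δ' → Δ' ⊆ U → (E.LDer Δ' T → E.LDer Δ T) → Δ' ⊆ Δ := fun Δ' h h' h'' =>
    hmax.le_of_ge ⟨h₁.trans h, h', h₃ ∘ h''⟩ h
  have one : ∀ A, A ∈ U → (E.LDer (insert A Δ) T → E.LDer Δ T) → A ∈ Δ := fun A hA h =>
    key _ (Set.subset_insert _ _) (Set.insert_subset hA h₂) h (Set.mem_insert _ _)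
  have two : ∀ A B, A ∈ U → B ∈ U → (E.LDer (insert A (insert B Δ)) T → E.LDer Δ T) →
      A ∈ Δ ∧ B ∈ Δ := fun A B hA hB h => by
    have := key _ ((Set.subset_insert _ _).trans (Set.subset_insert _ _))
      (Set.insert_subset hA (Set.insert_subset hB h₂)) h
    exact ⟨this (by simp), this (by simp)⟩
  have imm : ∀ {A B}, B ∈ Δ → A.Imm B → A ∈ pst (insert T Γ) := fun hB h =>
    mem_pst_of_imm (h₂ hB) h
  have hpU := pst_subset_St (insert T Γ)
  refine ⟨Δ, h₁, h₂, h₃, ⟨fun M N h => ?_, fun M K h hK => ?_, fun M K L h h' hKL => ?_,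
    fun M K h hK => ?_, fun M R K h hR => ?_, fun A h hA => ?_⟩⟩
  · exact two _ _ (hpU (imm h (Msg.imm_pair_left _ _))) (hpU (imm h (Msg.imm_pair_right _ _)))
      (.lp h)
  · exact (two _ _ (hpU (imm h (Msg.imm_enc_left _ _))) (hpU (imm h (Msg.imm_enc_right _ _)))
      (.le h hK)).1
  · exact one _ (hpU (imm h (Msg.imm_sign_left _ _))) (.sign h h' hKL)
  · exact (two _ _ (hpU (imm h (Msg.imm_blind_left _ _))) (hpU (imm h (Msg.imm_blind_right _ _)))
      (.blind₁ h hK)).1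
  · have hb := imm h (Msg.imm_sign_left _ _)
    exact (two _ _ (sign_mem_St (mem_pst_of_imm (hpU hb) (Msg.imm_blind_left _ _))
      (imm h (Msg.imm_sign_right _ _)))
      (hpU (mem_pst_of_imm (hpU hb) (Msg.imm_blind_right _ _))) (.blind₂ h hR)).1
  · exact one _ (hpU (mem_pst_of_factorOf (Set.insert_subset hTU h₂) h)) (.ls h hA)

/-- Closure of a set under the right rules, the symbols of the equational theory, and equality. -/
inductive Syn (E : Theory S) (Δ : Set (Msg S)) : Msg S → Prop
  | mem {M} : M ∈ Δ → Syn E Δ M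
  | con {c : Con} {args : Fin (S.headArity (.inl c)) → Msg S} : c ≠ .pub →
      (∀ i, Syn E Δ (args i)) → Syn E Δ (.node (.inl c) args)
  | app {f} {args : Fin (S.arity f) → Msg S} : (∀ i, Syn E Δ (args i)) → Syn E Δ (.app f args)
  | conv {M N} : E.Eqv M N → Syn E Δ M → Syn E Δ N

/-- `M` is a subterm of `T` or of an element of `Δ`. -/
def InSub (Δ : Set (Msg S)) (T M : Msg S) : Prop := ∃ N ∈ insert T Δ, M.Subterm N

/-- Every subterm of `T` or of `Δ` that is equal to `M` modulo `E` is derivable in `𝓡`. -/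
def Good (E : Theory S) (Δ : Set (Msg S)) (T M : Msg S) : Prop :=
  ∀ N, E.Eqv N M → InSub Δ T N → E.RDer Δ N

/-- The messages obtained by a right rule. -/
def built (E : Theory S) (Δ : Set (Msg S)) (T : Msg S) : Set (Msg S) :=
  {z | ∃ c args, c ≠ .pub ∧ (∀ i, Syn E Δ (args i) ∧ Good E Δ T (args i)) ∧
    z = .node (.inl c) args}

variable {Δ : Set (Msg S)} {T : Msg S}

theorem InSub.imm {M N : Msg S} (hN : InSub Δ T N) (h : M.Imm N) : InSub Δ T M := by
  obtain ⟨P, hP, hN⟩ := hN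
  exact ⟨P, hP, .head h hN⟩

theorem InSub.of_mem {M : Msg S} (h : M ∈ Δ) : InSub Δ T M := ⟨M, .inr h, .refl⟩

/-- Provides a derivable message to put in place of irrelevant alien terms. It comes from a leaf of
the `Syn` derivation: a member of Δ or a symbol of arity zero. -/
theorem Syn.exists_elementary {M : Msg S} (h : Syn E Δ M) : ∃ w, E.Elementary Δ w := by
  induction h with
  | mem h => exact ⟨_, .mem h⟩
  | @con c args hc _ ih =>
    cases c with
    | pub => exact absurd rfl hc
    | _ => exact ih (0 : Fin 2)
  | @app f args h ih =>
    by_cases hf : S.arity f = 0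
    · exact ⟨_, Elementary.app (f := f) (args := args) fun i => absurd i.2 (by omega)⟩
    · exact ih ⟨0, by omega⟩
  | conv _ _ ih => exact ih

theorem rder_of_sameHead_built {A z : Msg S} (hz : z ∈ built E Δ T) (h : SameHead E.Eqv A z)
    (hA : InSub Δ T A) : E.RDer Δ A := by
  obtain ⟨c, args, hc, hargs, rfl⟩ := hz
  cases h with
  | con _ args' _ h => exact RDer.con hc fun i => (hargs i).2 _ (h i) (hA.imm (imm_node _ i))

theorem LeftClosed.mem_of_maxAlien (hc : LeftClosed E Δ T) {A X : Msg S} (hA : A.MaxAlien X)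
    (hX : InSub Δ T X) (hne : A = X → A ∈ Δ) (h : E.RDer Δ A) : A ∈ Δ := by
  rcases hA.eq_or_isFactor with h' | h'
  · exact hne h'
  · obtain ⟨P, hP, hX⟩ := hX
    exact hc.factor A ⟨P, hP, h'.subterm_trans hX⟩ h

theorem InSub.of_maxAlien {A X : Msg S} (hX : InSub Δ T X) (hA : A.MaxAlien X) : InSub Δ T A := by
  obtain ⟨P, hP, hX⟩ := hX
  exact ⟨P, hP, hA.subterm.trans hX⟩

/-- The built messages are eliminated from the premises: one that matches a maximal alien of `N` or
of Δ is equal to an element of Δ, and any other can be replaced by `w` without affecting `N` or Δ.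
-/
theorem LeftClosed.good_of_elementary (hc : LeftClosed E Δ T) {M w : Msg S}
    (hw : E.Elementary Δ w) (hM : E.Elementary (Δ ∪ built E Δ T) M) : Good E Δ T M := by
  intro N hNM hN
  by_cases hz : ∃ z ∈ built E Δ T, SameHead E.Eqv N z
  · obtain ⟨z, hz, hNz⟩ := hz
    exact rder_of_sameHead_built hz hNz hN
  have hs := SameHead.equivalence (Eqv.equivalence (E := E))
  -- `P` consists of the terms related to no maximal alien of `N` or of Δ, so replacing its members
  -- fixes `N` and every element of Δ.
  set P : Set (Msg S) := {A | ¬ ∃ B, SameHead E.Eqv A B ∧ ∃ X ∈ insert N Δ, B.MaxAlien X} with hP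
  have hstable : E.AlienStable P := fun A B hAB _ hA ⟨C, hC, h⟩ => hA ⟨C, hs.trans hAB hC, h⟩
  have hself : ∀ X ∈ insert N Δ, Msg.replaceAliens P w X = X := fun X hX =>
    Msg.replaceAliens_eq_self fun A hA hAP => hAP ⟨A, hs.refl A, X, hX, hA⟩
  have hE' := (hM.conv hNM.symm).replaceAliens hstable w
  rw [hself N (.inl rfl)] at hE'
  refine .id (hE'.trans ?_)
  rintro _ ⟨z, hz' | hz', rfl⟩
  · rw [hself z (.inr hz')]
    exact .mem hz'
  · obtain ⟨c, args, -, -, hzc⟩ := id hz'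
    have hza : z.Alien := ⟨c, args, hzc⟩
    by_cases hzP : z ∈ P
    · rw [Msg.replaceAliens_of_mem hza hzP]
      exact hw
    · have hzP' := hzP
      rw [Msg.replaceAliens_eq_self]
      · simp only [hP, Set.mem_ofPred_eq, not_not] at hzP
        obtain ⟨B, hzB, X, hX, hBX⟩ := hzP
        have hXs : InSub Δ T X := by
          rcases hX with rfl | hX
          · exact hN
          · exact .of_mem hX
        have hBΔ : B ∈ Δ := by
          refine hc.mem_of_maxAlien hBX hXs ?_
            (rder_of_sameHead_built hz' (hs.symm hzB) (hXs.of_maxAlien hBX))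
          -- The alien `B` is now all of `X`. If `X` is `N`, then `N` matches a built message, the
          -- case settled at the outset; otherwise `X` is in Δ.
          rintro rfl
          rcases hX with rfl | hX
          · exact absurd ⟨z, hz', hs.symm hzB⟩ hz
          · exact hX
        exact (Elementary.mem hBΔ).conv (SameHead.eqv hzB hza).symm
      · rintro A hA
        subst hzc
        cases hA
        exact hzP'

/-- Constructor steps are absorbed as new atoms of `built`. The goodness of their arguments,
required there, comes from `good_of_elementary` applied to the induction hypotheses. -/
theorem LeftClosed.elementary_of_syn (hc : LeftClosed E Δ T) {M : Msg S} (h : Syn E Δ M) :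
    E.Elementary (Δ ∪ built E Δ T) M := by
  obtain ⟨w, hw⟩ := h.exists_elementary
  induction h with
  | mem h => exact .mem (.inl h)
  | con hpub h ih =>
    exact .mem (.inr ⟨_, _, hpub, fun i => ⟨h i, hc.good_of_elementary hw (ih i)⟩, rfl⟩)
  | app h ih => exact .app ih
  | conv h _ ih => exact ih.conv h

theorem LeftClosed.good_of_syn (hc : LeftClosed E Δ T) {M : Msg S} (h : Syn E Δ M) :
    Good E Δ T M := by
  obtain ⟨w, hw⟩ := h.exists_elementary
  exact hc.good_of_elementary hw (hc.elementary_of_syn h)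

theorem LeftClosed.rder_of_syn (hc : LeftClosed E Δ T) {M : Msg S} (h : Syn E Δ M)
    (hM : InSub Δ T M) : E.RDer Δ M :=
  hc.good_of_syn h M (Eqv.refl _) hM

/-- Inversion for the elimination rules: a synthesised alien term was either assembled from
synthesised arguments or was present in Δ, up to equality below its constructor. -/
theorem LeftClosed.syn_alien (hE : E.Convergent) (hc : LeftClosed E Δ T) {M : Msg S}
    (hM : M.Alien) (h : Syn E Δ M) :
    (∃ c args, c ≠ .pub ∧ (∀ i, Syn E Δ (args i)) ∧ SameHead E.Eqv M (.node (.inl c) args)) ∨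
      ∃ A ∈ Δ, SameHead E.Eqv M A := by
  by_cases hz : ∃ z ∈ built E Δ T, SameHead E.Eqv M z
  · obtain ⟨_, ⟨c, args, hpub, hargs, rfl⟩, h⟩ := hz
    exact .inl ⟨c, args, hpub, fun i => (hargs i).1, h⟩
  right
  have hs := SameHead.equivalence (Eqv.equivalence (E := E))
  have key : ∃ X ∈ Δ, ∃ A : Msg S, A.MaxAlien X ∧ SameHead E.Eqv M A := by
    by_contra hcon
    push Not at hcon
    -- No premise contains a maximal alien in the class of `M`, so replacing that class by `w`
    -- leaves the instantiated context unchanged and turns `M` into `w`.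
    refine hE.not_forall_eqv M fun w => ?_
    obtain ⟨k, C, Ms, h₁, h₂⟩ := hc.elementary_of_syn h
    have := h₂.replaceAliens (AlienStable.setOf_sameHead M) w
    rw [Msg.replaceAliens_of_mem (P := {N | SameHead E.Eqv M N}) hM (hs.refl M),
      Msg.replaceAliens_subst] at this
    refine h₂.symm.trans ?_
    convert this using 3 with i
    refine (Msg.replaceAliens_eq_self fun A hA hMA => ?_).symm
    rcases h₁ i with hi | hi
    · exact hcon _ hi A hA hMA
    · obtain ⟨c, args, -, -, hi'⟩ := id hi
      rw [hi'] at hA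
      cases hA
      exact hz ⟨_, hi, hi' ▸ hMA⟩
  obtain ⟨X, hX, A, hAX, hMA⟩ := key
  refine ⟨A, hc.mem_of_maxAlien hAX (.of_mem hX) (fun h => h ▸ hX) ?_, hMA⟩
  exact hc.rder_of_syn (h.conv (SameHead.eqv hMA hM)) ((InSub.of_mem hX).of_maxAlien hAX)

theorem LeftClosed.syn_of_nder (hE : E.Convergent) (hc : LeftClosed E Δ T)
    (hnormal : ∀ N ∈ Δ, E.Normal N) {Γ : Set (Msg S)} (hΓ : Γ ⊆ Δ) {M : Msg S}
    (h : E.NDer Γ M) : Syn E Δ M := by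
  have alien : ∀ (c : Con) args, (Msg.node (S := S) (.inl c) args).Alien :=
    fun c args => ⟨c, args, rfl⟩
  induction h with
  | id h => exact .mem (hΓ h)
  | @encE M K _ _ h₁ h₂ =>
    rcases hc.syn_alien hE (alien .enc _) h₁ with ⟨c, args, -, h, hs⟩ | ⟨A, hA, hs⟩
    · cases hs with
      | con _ _ _ hs => exact .conv (hs (0 : Fin 2)).symm (h (0 : Fin 2))
    · obtain ⟨M', K', rfl, hM, hK⟩ := SameHead.of_enc hs
      exact .conv hM.symm (.mem (hc.enc _ _ hA (hc.rder_of_syn (h₂.conv hK)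
        ((InSub.of_mem hA).imm (Msg.imm_enc_right _ _)))))
  | @blindE₁ M K _ _ h₁ h₂ =>
    rcases hc.syn_alien hE (alien .blind _) h₁ with ⟨c, args, -, h, hs⟩ | ⟨A, hA, hs⟩
    · cases hs with
      | con _ _ _ hs => exact .conv (hs (0 : Fin 2)).symm (h (0 : Fin 2))
    · obtain ⟨M', K', rfl, hM, hK⟩ := SameHead.of_blind hs
      exact .conv hM.symm (.mem (hc.blind _ _ hA (hc.rder_of_syn (h₂.conv hK)
        ((InSub.of_mem hA).imm (Msg.imm_blind_right _ _)))))
  | @pairE₁ M N _ h₁ =>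
    rcases hc.syn_alien hE (alien .pair _) h₁ with ⟨c, args, -, h, hs⟩ | ⟨A, hA, hs⟩
    · cases hs with
      | con _ _ _ hs => exact .conv (hs (0 : Fin 2)).symm (h (0 : Fin 2))
    · obtain ⟨M', N', rfl, hM, hN⟩ := SameHead.of_pair hs
      exact .conv hM.symm (.mem (hc.pair _ _ hA).1)
  | @pairE₂ M N _ h₁ =>
    rcases hc.syn_alien hE (alien .pair _) h₁ with ⟨c, args, -, h, hs⟩ | ⟨A, hA, hs⟩
    · cases hs with
      | con _ _ _ hs => exact .conv (hs (1 : Fin 2)).symm (h (1 : Fin 2))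
    · obtain ⟨M', N', rfl, hM, hN⟩ := SameHead.of_pair hs
      exact .conv hN.symm (.mem (hc.pair _ _ hA).2)
  | @signE M K _ _ h₁ h₂ =>
    rcases hc.syn_alien hE (alien .sign _) h₁ with ⟨c, args, -, h, hs⟩ | ⟨A, hA, hs⟩
    · cases hs with
      | con _ _ _ hs => exact .conv (hs (0 : Fin 2)).symm (h (0 : Fin 2))
    · obtain ⟨M', K', rfl, hM, hK⟩ := SameHead.of_sign hs
      -- Public keys are never assembled, so this one matches an element of Δ. Both keys are then
      -- normal, and equality modulo `E` improves to the AC equality that the rule asks for.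
      rcases hc.syn_alien hE (alien .pub _) h₂ with ⟨c, args, hpub, h, hs'⟩ | ⟨B, hB, hs'⟩
      · cases hs' with
        | con => exact absurd rfl hpub
      · obtain ⟨L, rfl, hL⟩ := SameHead.of_pub hs'
        exact .conv hM.symm (.mem (hc.sign _ _ _ hA hB (hE.acEq_of_eqv
          ((hnormal _ hA).subterm (.single (Msg.imm_sign_right _ _)))
          ((hnormal _ hB).subterm (.single (Msg.imm_pub _))) (hK.symm.trans hL))))
  | @blindE₂ M R K _ _ h₁ h₂ =>
    have sign : ∀ {K'}, Syn E Δ M → Syn E Δ K' → E.Eqv K K' → Syn E Δ (.sign M K) :=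
      fun hM hK h => .con (c := .sign) (by simp) fun i => by
        change Fin 2 at i
        fin_cases i
        · exact hM
        · exact .conv h.symm hK
    rcases hc.syn_alien hE (alien .sign _) h₁ with ⟨c, args, -, h, hs⟩ | ⟨A, hA, hs⟩
    · cases hs with
      | con _ _ _ hs =>
        refine sign ?_ (h (1 : Fin 2)) (hs (1 : Fin 2))
        have hb : Syn E Δ (.blind M R) := .conv (hs (0 : Fin 2)).symm (h (0 : Fin 2))
        -- The signature was assembled, so its blinded content is synthesised in turn. Either way
        -- `M` becomes available, and the signature is rebuilt from it.
        rcases hc.syn_alien hE (alien .blind _) hb with ⟨c, args, -, h, hs⟩ | ⟨A, hA, hs⟩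
        · cases hs with
          | con _ _ _ hs => exact .conv (hs (0 : Fin 2)).symm (h (0 : Fin 2))
        · obtain ⟨M', R', rfl, hM, hR⟩ := SameHead.of_blind hs
          exact .conv hM.symm (.mem (hc.blind _ _ hA (hc.rder_of_syn (h₂.conv hR)
            ((InSub.of_mem hA).imm (Msg.imm_blind_right _ _)))))
    · obtain ⟨X, K', rfl, hX, hK⟩ := SameHead.of_sign hs
      -- The content `X` of the stored signature is only equal to a blinded message modulo `E`.
      -- Normality gives it a constructor at the head, and freeness shows that this is `blind`.
      have hXn : E.Normal X := (hnormal _ hA).subterm (.single (Msg.imm_sign_left _ _))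
      obtain ⟨args, hXa⟩ := hE.con_of_eqv hXn hX.symm
      obtain ⟨M', R', rfl, hM, hR⟩ := SameHead.of_blind
        (hE.sameHead_of_eqv (alien .blind _) ⟨_, _, hXa⟩ hX)
      have := hc.unblind _ _ _ hA (hc.rder_of_syn (h₂.conv hR)
        (((InSub.of_mem hA).imm (Msg.imm_sign_left _ _)).imm (Msg.imm_blind_right _ _)))
      refine .conv (Eqv.congr (.inl .sign) fun i => ?_) (.mem this)
      change Fin 2 at i
      fin_cases i
      · exact hM.symm
      · exact hK.symm
  | encI _ _ h₁ h₂ =>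
    exact .con (c := .enc) (by simp) fun i => by change Fin 2 at i; fin_cases i <;> assumption
  | pairI _ _ h₁ h₂ =>
    exact .con (c := .pair) (by simp) fun i => by change Fin 2 at i; fin_cases i <;> assumption
  | signI _ _ h₁ h₂ =>
    exact .con (c := .sign) (by simp) fun i => by change Fin 2 at i; fin_cases i <;> assumption
  | blindI _ _ h₁ h₂ =>
    exact .con (c := .blind) (by simp) fun i => by change Fin 2 at i; fin_cases i <;> assumption
  | appI _ h => exact .app h
  | conv h _ ih => exact .conv h.symm ih

theorem Convergent.lder_of_nder (hE : E.Convergent) {Γ : Set (Msg S)} (hΓ : Γ.Finite) {M : Msg S}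
    (hn : E.NormalSequent Γ M) (h : E.NDer Γ M) : E.LDer Γ M := by
  obtain ⟨Δ, h₁, h₂, h₃, hc⟩ := exists_leftClosed (E := E) hΓ M
  have hnormal : ∀ N ∈ Δ, E.Normal N := fun N hN =>
    Normal.of_mem_St hE (by rintro P (rfl | hP); exacts [hn.2, hn.1 P hP]) (h₂ hN)
  exact h₃ (.r (hc.rder_of_syn (hc.syn_of_nder hE hnormal h₁ h) ⟨M, .inl rfl, .refl⟩))

end Theory

end IntruderDeduction

/-! ### A calculus of programs with polynomial overhead. -/

namespace IntruderDeduction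

/-! ### Computations with polynomial overhead -/

/-- The number of steps allowed on inputs of size `n`, for the exponent `k` and the factor `c`. -/
def cost (F : ℕ → ℕ) (k c n : ℕ) : ℕ := c * ((n + 1) ^ k * (F n + 1))

theorem cost_add (F : ℕ → ℕ) (k l c d n : ℕ) :
    cost F k c n + cost F l d n ≤ cost F (k + l) (c + d) n := by
  have h₁ : (n + 1) ^ k ≤ (n + 1) ^ (k + l) := Nat.pow_le_pow_right (by omega) (by omega)
  have h₂ : (n + 1) ^ l ≤ (n + 1) ^ (k + l) := Nat.pow_le_pow_right (by omega) (by omega)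
  unfold cost
  rw [add_mul]
  gcongr

theorem le_cost (F : ℕ → ℕ) (k c n : ℕ) : c ≤ cost F k c n :=
  Nat.le_mul_of_pos_right _ (by positivity)

theorem cost_add_const (F : ℕ → ℕ) (k c d n : ℕ) : cost F k c n + d ≤ cost F k (c + d) n :=
  (Nat.add_le_add_left (le_cost F 0 d n) _).trans (cost_add F k 0 c d n)

/-- A loop with linearly many rounds raises the exponent by one. -/
theorem mul_cost (F : ℕ → ℕ) (C k c n : ℕ) :
    C * (n + 1) * cost F k c n = cost F (k + 1) (C * c) n := by
  unfold cost
  ring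

/-- `y i` is computable from `x i`, uniformly in `i`, in time polynomial in the size `s i` times
`F o (s i) + 1`. The program and the constant factor, but not the exponent, may depend on `o`. -/
def PComp {O ι : Type} (F : O → ℕ → ℕ) (s : ι → ℕ) (x y : ι → Val) : Prop :=
  ∃ k : ℕ, ∀ o : O, ∃ (p : Prog) (c : ℕ), ∀ i, ∃ t ≤ cost (F o) k c (s i),
    Prog.Runs p (x i) (y i) t

/-- `P i` is decidable from `x i`, uniformly in `i`, within the bounds of `PComp`. -/
def Dec {O ι : Type} (F : O → ℕ → ℕ) (s : ι → ℕ) (x : ι → Val) (P : ι → Prop) : Prop :=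
  PComp F s x fun i => Val.truth (P i)

section

variable {O ι : Type} {F : O → ℕ → ℕ} {s : ι → ℕ} {x y z : ι → Val}

theorem PComp.of_runs (p : Prog) (c : ℕ) (h : ∀ i, p.Runs (x i) (y i) c) : PComp F s x y :=
  ⟨0, fun o => ⟨p, c, fun i => ⟨c, le_cost (F o) 0 c _, h i⟩⟩⟩

theorem PComp.refl (x : ι → Val) : PComp F s x x := .of_runs .skip 1 fun _ => .skip

theorem PComp.const (v : Val) : PComp F s x fun _ => v := .of_runs (.const v) 1 fun _ => .const

theorem PComp.trans (h₁ : PComp F s x y) (h₂ : PComp F s y z) : PComp F s x z := by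
  obtain ⟨k, h₁⟩ := h₁
  obtain ⟨l, h₂⟩ := h₂
  refine ⟨k + l, fun o => ?_⟩
  obtain ⟨p, c, hp⟩ := h₁ o
  obtain ⟨q, d, hq⟩ := h₂ o
  refine ⟨.seq p q, c + d + 1, fun i => ?_⟩
  obtain ⟨t, ht, hp⟩ := hp i
  obtain ⟨u, hu, hq⟩ := hq i
  refine ⟨_, ?_, .seq hp hq⟩
  have h₁ := cost_add (F o) k l c d (s i)
  have h₂ := cost_add_const (F o) (k + l) (c + d) 1 (s i)
  omega

theorem PComp.pair (h₁ : PComp F s x y) (h₂ : PComp F s x z) :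
    PComp F s x fun i => .pair (y i) (z i) := by
  obtain ⟨k, h₁⟩ := h₁
  obtain ⟨l, h₂⟩ := h₂
  refine ⟨k + l, fun o => ?_⟩
  obtain ⟨p, c, hp⟩ := h₁ o
  obtain ⟨q, d, hq⟩ := h₂ o
  refine ⟨.pair p q, c + d + 1, fun i => ?_⟩
  obtain ⟨t, ht, hp⟩ := hp i
  obtain ⟨u, hu, hq⟩ := hq i
  refine ⟨_, ?_, .pair hp hq⟩
  have h₁ := cost_add (F o) k l c d (s i)
  have h₂ := cost_add_const (F o) (k + l) (c + d) 1 (s i)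
  omega

theorem PComp.fst (h : PComp F s x y) : PComp F s x fun i => (y i).fst :=
  h.trans (.of_runs .fst 1 fun _ => .fst)

theorem PComp.snd (h : PComp F s x y) : PComp F s x fun i => (y i).snd :=
  h.trans (.of_runs .snd 1 fun _ => .snd)

/-- Used for nested loops: a loop body runs on a family indexed by an instance together with a list
element, and facts about the outer family are pulled back to it. -/
theorem PComp.reparam {κ : Type} (h : PComp F s x y) (g : κ → ι) :
    PComp F (s ∘ g) (x ∘ g) (y ∘ g) := by
  obtain ⟨k, h⟩ := h
  refine ⟨k, fun o => ?_⟩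
  obtain ⟨p, c, hp⟩ := h o
  exact ⟨p, c, fun k => hp (g k)⟩

theorem PComp.congr (h : PComp F s x y) (hyz : ∀ i, y i = z i) : PComp F s x z := by
  rwa [← funext hyz]

theorem Dec.congr {P Q : ι → Prop} (h : Dec F s x P) (hPQ : ∀ i, P i ↔ Q i) : Dec F s x Q := by
  rwa [← funext fun i => propext (hPQ i)]

open Classical in
theorem Dec.ite {P : ι → Prop} (h : Dec F s x P) (h₁ : PComp F s x y) (h₂ : PComp F s x z) :
    PComp F s x fun i => if P i then y i else z i := by
  obtain ⟨m, h⟩ := h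
  obtain ⟨k, h₁⟩ := h₁
  obtain ⟨l, h₂⟩ := h₂
  refine ⟨m + (k + l), fun o => ?_⟩
  obtain ⟨r, e, hr⟩ := h o
  obtain ⟨p, c, hp⟩ := h₁ o
  obtain ⟨q, d, hq⟩ := h₂ o
  refine ⟨.cond r p q, e + (c + d) + 1, fun i => ?_⟩
  obtain ⟨v, hv, hr⟩ := hr i
  obtain ⟨t, ht, hp⟩ := hp i
  obtain ⟨u, hu, hq⟩ := hq i
  have h₁ := cost_add (F o) k l c d (s i)
  have h₂ := cost_add (F o) m (k + l) e (c + d) (s i)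
  have h₃ := cost_add_const (F o) (m + (k + l)) (e + (c + d)) 1 (s i)
  by_cases hP : P i
  · simp only [Val.truth, hP, if_true] at hr ⊢
    exact ⟨_, by omega, .condTrue hr (by simp) hp⟩
  · simp only [Val.truth, hP, if_false] at hr ⊢
    exact ⟨_, by omega, .condFalse hr hq⟩

theorem Dec.not {P : ι → Prop} (h : Dec F s x P) : Dec F s x fun i => ¬ P i :=
  (h.ite (.const (.atom 0)) (.const (.atom 1))).congr fun i => by
    by_cases hP : P i <;> simp [Val.truth, hP]

theorem Dec.and {P Q : ι → Prop} (h : Dec F s x P) (h' : Dec F s x Q) :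
    Dec F s x fun i => P i ∧ Q i :=
  (h.ite h' (.const (.atom 0))).congr fun i => by
    by_cases hP : P i <;> by_cases hQ : Q i <;> simp [Val.truth, hP, hQ]

theorem Dec.or {P Q : ι → Prop} (h : Dec F s x P) (h' : Dec F s x Q) :
    Dec F s x fun i => P i ∨ Q i :=
  (h.ite (.const (.atom 1)) h').congr fun i => by
    by_cases hP : P i <;> by_cases hQ : Q i <;> simp [Val.truth, hP, hQ]

theorem Dec.atom_eq {a b : ι → ℕ} (ha : PComp F s x fun i => .atom (a i))
    (hb : PComp F s x fun i => .atom (b i)) : Dec F s x fun i => a i = b i :=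
  ((ha.pair hb).trans (.of_runs .eqAtoms 1 fun _ => .eqAtoms)).congr fun i => by
    by_cases h : a i = b i <;> simp [Val.eqAtoms, Val.truth, h]

theorem Dec.of_truth {P : ι → Prop} (h : PComp F s x fun i => Val.truth (P i)) : Dec F s x P := h

/-- The loop that applies `q` to the elements of a list and an accumulator. -/
def foldLoop (q : Prog) : Prog :=
  .loop (.seq .fst .isPair)
    (.pair (.seq .fst .snd)
      (.pair (.seq (.pair (.pair (.seq .fst .fst) (.seq .snd .fst)) (.seq .snd .snd)) q)
        (.seq .snd .snd)))

/-- The loop state is the remaining list, the accumulator and the unchanged input `X`. The constant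
30 bounds the bookkeeping of one round. -/
theorem foldLoop_runs (q : Prog) (X : Val) (T : ℕ) (l : List Val) (st : ℕ → Val)
    (h : ∀ j (hj : j < l.length), ∃ t ≤ T, q.Runs (.pair (.pair l[j] (st j)) X) (st (j + 1)) t) :
    ∃ t ≤ (l.length + 1) * (T + 30), (foldLoop q).Runs (.pair (.list l) (.pair (st 0) X))
      (.pair (.list []) (.pair (st l.length) X)) t := by
  induction l generalizing st with
  | nil => exact ⟨4, by simp, .loopStop (.seq .fst .isPair)⟩
  | cons a l ih =>
    obtain ⟨t, ht, hq⟩ := h 0 (by simp)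
    obtain ⟨u, hu, hl⟩ := ih (fun j => st (j + 1)) fun j hj => h (j + 1) (by simpa using hj)
    refine ⟨_, ?_, .loopStep (.seq .fst .isPair) (by simp [Val.list, Val.fst, Val.isPair])
      (.pair (.seq .fst .snd) (.pair (.seq (.pair (.pair (.seq .fst .fst) (.seq .snd .fst))
        (.seq .snd .snd)) hq) (.seq .snd .snd))) hl⟩
    simp only [List.length_cons]
    rw [show (l.length + 1 + 1) * (T + 30) = (l.length + 1) * (T + 30) + (T + 30) by ring]
    omega

theorem PComp.fold_val (l : ι → List Val) (st : ι → ℕ → Val) (C : ℕ)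
    (hlen : ∀ i, (l i).length ≤ C * (s i + 1)) (hl : PComp F s x fun i => .list (l i))
    (h₀ : PComp F s x fun i => st i 0)
    (hstep : PComp F (fun k : (i : ι) × Fin (l i).length => s k.1)
      (fun k => .pair (.pair (l k.1)[k.2] (st k.1 k.2)) (x k.1)) fun k => st k.1 (k.2 + 1)) :
    PComp F s x fun i => st i (l i).length := by
  obtain ⟨m, hstep⟩ := hstep
  have hloop : PComp F s (fun i => .pair (.list (l i)) (.pair (st i 0) (x i)))
      fun i => .pair (.list []) (.pair (st i (l i).length) (x i)) := by
    refine ⟨m + 1, fun o => ?_⟩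
    obtain ⟨q, c, hq⟩ := hstep o
    refine ⟨foldLoop q, (C + 1) * (c + 30), fun i => ?_⟩
    obtain ⟨t, ht, hr⟩ := foldLoop_runs q (x i) (cost (F o) m c (s i)) (l i) (st i)
      fun j hj => hq ⟨i, j, hj⟩
    refine ⟨t, ht.trans (le_of_le_of_eq ?_ (mul_cost (F o) (C + 1) m (c + 30) (s i))), hr⟩
    exact Nat.mul_le_mul (by nlinarith [hlen i]) (cost_add_const (F o) m c 30 (s i))
  exact ((hl.pair (h₀.pair (.refl x))).trans hloop).snd.fst

/-- Iteration along a list whose elements are represented by `e`. -/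
theorem PComp.fold {α : Type} (l : ι → List α) (e : ι → α → Val) (st : ι → ℕ → Val) (C : ℕ)
    (hlen : ∀ i, (l i).length ≤ C * (s i + 1))
    (hl : PComp F s x fun i => .list ((l i).map (e i))) (h₀ : PComp F s x fun i => st i 0)
    (hstep : ∀ {κ : Type} (g : κ → ι) (x' : κ → Val) (j : κ → ℕ) (a : κ → α),
      (∀ k, (l (g k))[j k]? = some (a k)) → PComp F (s ∘ g) x' (x ∘ g) →
      PComp F (s ∘ g) x' (fun k => e (g k) (a k)) → PComp F (s ∘ g) x' (fun k => st (g k) (j k)) →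
      PComp F (s ∘ g) x' fun k => st (g k) (j k + 1)) :
    PComp F s x fun i => st i (l i).length := by
  have := PComp.fold_val (x := x) (F := F) (s := s) (fun i => (l i).map (e i)) st C (by simpa) hl h₀
    (hstep (κ := (i : ι) × Fin ((l i).map (e i)).length) (fun k => k.1) _ (fun k => k.2)
      (fun k => (l k.1)[k.2.1]'(by simpa using k.2.2))
      (fun k => List.getElem?_eq_getElem (by simpa using k.2.2)) (PComp.refl _).snd ?_
      (PComp.refl _).fst.snd)
  · simpa using this
  · exact (PComp.refl _).fst.fst.congr fun k => by simp [Val.fst]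

theorem Dec.exists_mem {α : Type} (l : ι → List α) (e : ι → α → Val) (C : ℕ)
    (hlen : ∀ i, (l i).length ≤ C * (s i + 1))
    (hl : PComp F s x fun i => .list ((l i).map (e i))) {P : ι → α → Prop}
    (hP : ∀ {κ : Type} (g : κ → ι) (x' : κ → Val) (a : κ → α), (∀ k, a k ∈ l (g k)) →
      PComp F (s ∘ g) x' (x ∘ g) → PComp F (s ∘ g) x' (fun k => e (g k) (a k)) →
      Dec F (s ∘ g) x' fun k => P (g k) (a k)) :
    Dec F s x fun i => ∃ a ∈ l i, P i a := by
  -- The accumulator is the truth value of the statement for the prefix already read.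
  refine (PComp.fold l e (fun i j => Val.truth (∃ a ∈ (l i).take j, P i a)) C hlen hl
    ((PComp.const (.atom 0)).congr fun i => by simp [Val.truth]) ?_).congr fun i => by
      rw [List.take_length]
  intro κ g x' j a ha hx he hst
  refine (Dec.or (Dec.of_truth hst)
    (hP g x' a (fun k => List.mem_of_getElem? (ha k)) hx he)).congr fun k => ?_
  simp [List.take_add_one, ha k, or_and_right, exists_or]

-- The order is reversed because each selected element is pushed onto the front of the accumulator.
open Classical in
theorem PComp.filterMap {α : Type} (l : ι → List α) (e r : ι → α → Val) (C : ℕ)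
    (hlen : ∀ i, (l i).length ≤ C * (s i + 1))
    (hl : PComp F s x fun i => .list ((l i).map (e i))) {P : ι → α → Prop}
    (hP : ∀ {κ : Type} (g : κ → ι) (x' : κ → Val) (a : κ → α), (∀ k, a k ∈ l (g k)) →
      PComp F (s ∘ g) x' (x ∘ g) → PComp F (s ∘ g) x' (fun k => e (g k) (a k)) →
      Dec F (s ∘ g) x' (fun k => P (g k) (a k)) ∧
      PComp F (s ∘ g) x' fun k => r (g k) (a k)) :
    PComp F s x fun i => .list (((l i).filter (P i ·)).reverse.map (r i)) := by
  refine (PComp.fold l e (fun i j => .list ((((l i).take j).filter (P i ·)).reverse.map (r i))) C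
    hlen hl ((PComp.const (.atom 0)).congr fun i => by simp [Val.list]) ?_).congr fun i => by
      rw [List.take_length]
  intro κ g x' j a ha hx he hst
  obtain ⟨h₁, h₂⟩ := hP g x' a (fun k => List.mem_of_getElem? (ha k)) hx he
  refine (h₁.ite (h₂.pair hst) hst).congr fun k => ?_
  by_cases h : P (g k) (a k) <;> simp [List.take_add_one, ha k, h, Val.list]

end

/-! ### Closures computed by iteration -/

open Classical in
/-- The stages of an iteration that selects from `l` the elements `a` with `P X a`, where `X` is
the set of the elements selected at the preceding stage. -/
noncomputable def stage {α : Type} (l : List α) (P : Set α → α → Prop) (X₀ : List α) : ℕ → List α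
  | 0 => X₀
  | j + 1 => (l.filter (P {a | a ∈ stage l P X₀ j} ·)).reverse

section

variable {α : Type} {l : List α} {P : Set α → α → Prop} {X₀ : List α}

theorem mem_stage_succ {j : ℕ} {a : α} :
    a ∈ stage l P X₀ (j + 1) ↔ a ∈ l ∧ P {a | a ∈ stage l P X₀ j} a := by
  simp [stage]

theorem stage_subset (h₀ : X₀ ⊆ l) (j : ℕ) : stage l P X₀ j ⊆ l := by
  cases j with
  | zero => exact h₀
  | succ j => exact fun a ha => (mem_stage_succ.1 ha).1

theorem stage_length_le (h₀ : X₀.length ≤ l.length) (j : ℕ) :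
    (stage l P X₀ j).length ≤ l.length := by
  cases j with
  | zero => exact h₀
  | succ j => simpa [stage] using List.length_filter_le _ _

theorem stage_induction {Q : α → Prop} (h₀ : ∀ a ∈ X₀, Q a)
    (h : ∀ X : Set α, (∀ a ∈ X, Q a) → ∀ a ∈ l, P X a → Q a) (j : ℕ) :
    ∀ a ∈ stage l P X₀ j, Q a := by
  induction j with
  | zero => exact h₀
  | succ j ih => exact fun a ha => h _ ih a (mem_stage_succ.1 ha).1 (mem_stage_succ.1 ha).2

theorem stage_mono (h₀ : X₀ ⊆ l) (hP : ∀ X, ∀ a ∈ X, P X a) {i j : ℕ} (hij : i ≤ j) :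
    stage l P X₀ i ⊆ stage l P X₀ j := by
  induction j, hij using Nat.le_induction with
  | base => exact fun _ h => h
  | succ j _ ih =>
    exact fun a ha => mem_stage_succ.2 ⟨stage_subset h₀ j (ih ha), hP _ a (ih ha)⟩

-- Stages increase, and each depends only on the set of elements of the preceding one. One
-- repetition therefore makes all later stages equal. Without a repetition the cardinality would
-- grow at each of `l.length + 1` steps and exceed that of `l`. Monotonicity of `P` in its set
-- argument is not needed.
open Classical in
theorem stage_closed (h₀ : X₀ ⊆ l) (hP : ∀ X, ∀ a ∈ X, P X a) {a : α} (ha : a ∈ l)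
    (h : P {a | a ∈ stage l P X₀ l.length} a) : a ∈ stage l P X₀ l.length := by
  by_contra hcon
  have hne : ∀ j ≤ l.length, ¬ (stage l P X₀ (j + 1) ⊆ stage l P X₀ j) := by
    intro j hj hsub
    have heq : ∀ k, {a | a ∈ stage l P X₀ (j + k)} = {a | a ∈ stage l P X₀ j} := by
      intro k
      induction k with
      | zero => rfl
      | succ k ih =>
        ext b
        rw [Set.mem_ofPred_eq, ← add_assoc, mem_stage_succ, ih, ← mem_stage_succ]
        exact ⟨fun h => hsub h, fun h => stage_mono h₀ hP (by omega) h⟩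
    have h₁ := heq (l.length - j)
    have h₂ := heq (l.length - j + 1)
    rw [← add_assoc] at h₂
    rw [show j + (l.length - j) = l.length by omega] at h₁ h₂
    exact hcon (h₁.symm ▸ h₂ ▸ mem_stage_succ.2 ⟨ha, h⟩ : a ∈ {a | a ∈ stage l P X₀ l.length})
  have hcard : ∀ j ≤ l.length + 1, j ≤ (stage l P X₀ j).toFinset.card := by
    intro j
    induction j with
    | zero => simp
    | succ j ih =>
      intro hj
      refine Nat.succ_le_of_lt ((ih (by omega)).trans_lt (Finset.card_lt_card ?_))
      refine Finset.ssubset_iff_subset_ne.2 ⟨fun b hb => ?_, fun heq => hne j (by omega) ?_⟩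
      · simpa using stage_mono h₀ hP (Nat.le_succ j) (by simpa using hb)
      · intro b hb
        have : b ∈ (stage l P X₀ (j + 1)).toFinset := by simpa using hb
        rw [← heq] at this
        simpa using this
  have h₁ := hcard _ le_rfl
  have h₂ : (stage l P X₀ (l.length + 1)).toFinset.card ≤ l.toFinset.card :=
    Finset.card_le_card fun b hb => by
      simpa using stage_subset h₀ _ (by simpa using hb)
  have h₃ := l.toFinset_card_le
  omega

end

theorem PComp.iterate {O ι : Type} {F : O → ℕ → ℕ} {s : ι → ℕ} {x : ι → Val}
    {α : Type} (l : ι → List α) (e r : ι → α → Val) (P : ι → Set α → α → Prop) (X₀ : ι → List α) (C : ℕ)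
    (hlen : ∀ i, (l i).length ≤ C * (s i + 1))
    (hl : PComp F s x fun i => .list ((l i).map (e i)))
    (hX₀ : ∀ i, X₀ i ⊆ l i) (hX₀' : ∀ i, (X₀ i).length ≤ (l i).length)
    (h₀ : PComp F s x fun i => .list ((X₀ i).map (r i)))
    (hP : ∀ {κ : Type} (g : κ → ι) (x' : κ → Val) (X : κ → List α) (a : κ → α),
      (∀ k, X k ⊆ l (g k)) → (∀ k, (X k).length ≤ (l (g k)).length) → (∀ k, a k ∈ l (g k)) →
      PComp F (s ∘ g) x' (x ∘ g) →
      PComp F (s ∘ g) x' (fun k => .list ((X k).map (r (g k)))) →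
      PComp F (s ∘ g) x' (fun k => e (g k) (a k)) →
      Dec F (s ∘ g) x' (fun k => P (g k) {b | b ∈ X k} (a k)) ∧
      PComp F (s ∘ g) x' fun k => r (g k) (a k)) :
    PComp F s x fun i => .list ((stage (l i) (P i) (X₀ i) (l i).length).map (r i)) := by
  refine PComp.fold l e (fun i j => .list ((stage (l i) (P i) (X₀ i) j).map (r i)))
    C hlen hl h₀ ?_
  intro κ g x' j a ha hx he hst
  refine PComp.filterMap (fun k => l (g k)) (fun k => e (g k)) (fun k => r (g k)) C
    (fun k => hlen (g k)) (hx.trans (hl.reparam g)) ?_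
  intro κ' g' x'' b hb hx' he'
  exact hP (g ∘ g') x'' (fun k => stage (l (g (g' k))) (P (g (g' k)))
    (X₀ (g (g' k))) (j (g' k))) b (fun k => stage_subset (hX₀ _) _)
    (fun k => stage_length_le (hX₀' _) _) hb (hx'.trans (hx.reparam g'))
    (hx'.trans (hst.reparam g')) he'

end IntruderDeduction

/-! ### Deduction instances as machine data. -/

namespace IntruderDeduction

variable {S : Signature}

/-! ### The machine representation of nodes -/

namespace Msg

/-- The kind of a message: a name, headed by a constructor, or headed by a symbol of `S`. -/
def tag : Msg S → ℕ
  | .name _ => 0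
  | .node (.inl _) _ => 1
  | .node (.inr _) _ => 2

/-- The number of the head symbol. -/
def headCode : Msg S → ℕ
  | .name _ => 0
  | .node (.inl c) _ => c.code
  | .node (.inr f) _ => S.code f

/-- The list of the immediate subterms. -/
def kids : Msg S → List (Msg S)
  | .name _ => []
  | .node _ args => List.ofFn args

theorem mem_kids {M N : Msg S} : M ∈ N.kids ↔ M.Imm N := by
  constructor
  · intro h
    cases N with
    | name a => cases h
    | node g args =>
      obtain ⟨i, rfl⟩ := (List.mem_ofFn' _ _).1 h
      exact imm_node args i
  · rintro ⟨g, args, i, rfl, rfl⟩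
    exact (List.mem_ofFn' _ _).2 ⟨i, rfl⟩

theorem nodeBody_fst (ptr : Msg S → ℕ) (M : Msg S) : (nodeBody ptr M).fst = .atom M.tag := by
  match M with
  | .name a => rfl
  | .node (.inl c) args => rfl
  | .node (.inr f) args => rfl

theorem nodeBody_snd_fst (ptr : Msg S → ℕ) (M : Msg S) :
    (nodeBody ptr M).snd.fst = .atom M.headCode := by
  match M with
  | .name a => rfl
  | .node (.inl c) args => rfl
  | .node (.inr f) args => rfl

theorem nodeBody_snd_snd (ptr : Msg S → ℕ) (M : Msg S) :
    (nodeBody ptr M).snd.snd = .list (M.kids.map fun N => .atom (ptr N)) := by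
  match M with
  | .name a => rfl
  | .node (.inl c) args => simp [nodeBody, Val.snd, kids, Function.comp_def]
  | .node (.inr f) args => simp [nodeBody, Val.snd, kids, Function.comp_def]

theorem exists_args_of_headCode {M : Msg S} {c : Con} (h₁ : M.tag = 1) (h₂ : M.headCode = c.code) :
    ∃ args, M = .node (.inl c) args := by
  match M, h₁, h₂ with
  | .node (.inl d) args, _, h =>
    have : d = c := by cases c <;> cases d <;> first | rfl | cases h
    subst this
    exact ⟨args, rfl⟩

/-- Argument lists may repeat a node, so the number of nodes does not bound their length; the arity
bound does. -/
theorem length_kids_le (S : Signature) : ∃ B : ℕ, ∀ M : Msg S, M.kids.length ≤ B := by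
  obtain ⟨B, hB⟩ := S.arity_bounded
  refine ⟨B + 2, fun M => ?_⟩
  match M with
  | .name a => simp [kids]
  | .node (.inl c) args =>
    simp only [kids, List.length_ofFn]
    cases c <;> simp [Signature.headArity, Con.arity]
  | .node (.inr f) args =>
    simp only [kids, List.length_ofFn]
    exact (hB f).trans (by omega)

end Msg

theorem Val.fst_list_atom (l : List ℕ) : (Val.list (l.map .atom)).fst = .atom (l.headD 0) := by
  cases l <;> rfl

theorem Val.snd_list_map {α : Type} (e : α → Val) (l : List α) :
    (Val.list (l.map e)).snd = .list (l.tail.map e) := by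
  cases l <;> rfl

/-! ### Instances of deduction problems -/

/-- A finite sequent in normal form with a DAG representation of its saturated set. -/
structure Inst (E : Theory S) where
  Γ : Set (Msg S)
  M : Msg S
  nodes : List (Msg S)
  ptr : Msg S → ℕ
  finite : Γ.Finite
  normal : E.NormalSequent Γ M
  nodup : nodes.Nodup
  mem_nodes : ∀ T, T ∈ nodes ↔ T ∈ St (insert M Γ)
  inj : Set.InjOn ptr (St (insert M Γ))

namespace Inst

variable {E : Theory S}

/-- The number of nodes. -/
noncomputable def size (I : Inst E) : ℕ := (St (insert I.M I.Γ)).ncard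

/-- The machine representation of a node. -/
noncomputable def entry (I : Inst E) (T : Msg S) : Val := nodeEntry I.ptr I.Γ I.M T

/-- The machine representation of the instance. -/
noncomputable def input (I : Inst E) : Val := .list (I.nodes.map I.entry)

theorem length_nodes (I : Inst E) : I.nodes.length = I.size := by
  classical
  rw [size, ← List.toFinset_card_of_nodup I.nodup, ← Set.ncard_coe_finset]
  congr 1
  ext T
  simp [I.mem_nodes]

theorem ptr_inj (I : Inst E) {A B : Msg S} (hA : A ∈ I.nodes) (hB : B ∈ I.nodes) :
    I.ptr A = I.ptr B ↔ A = B :=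
  I.inj.eq_iff ((I.mem_nodes A).1 hA) ((I.mem_nodes B).1 hB)

theorem mem_nodes_of_imm (I : Inst E) {A B : Msg S} (hB : B ∈ I.nodes) (h : A.Imm B) :
    A ∈ I.nodes :=
  (I.mem_nodes A).2 (pst_subset_St _ (mem_pst_of_imm ((I.mem_nodes B).1 hB) h))

theorem mem_nodes_of_mem (I : Inst E) {A : Msg S} (h : A ∈ I.Γ) : A ∈ I.nodes :=
  (I.mem_nodes A).2 (subset_St _ (.inr h))

theorem M_mem_nodes (I : Inst E) : I.M ∈ I.nodes :=
  (I.mem_nodes I.M).2 (subset_St _ (.inl rfl))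

/-- Idempotence of `St` keeps the saturated set of any sequent of nodes within the nodes, so
subproblems reuse the given graph and its addresses. -/
theorem St_subset_nodes (I : Inst E) {X : Set (Msg S)} {A : Msg S} (hX : ∀ B ∈ X, B ∈ I.nodes)
    (hA : A ∈ I.nodes) {B : Msg S} (hB : B ∈ St (insert A X)) : B ∈ I.nodes := by
  refine (I.mem_nodes B).2 (St_subset ?_ hB)
  rintro C (rfl | hC)
  · exact (I.mem_nodes C).1 hA
  · exact (I.mem_nodes C).1 (hX C hC)

open Classical in
/-- The instance with hypotheses `X` and target `A` inside the nodes of `I`. -/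
noncomputable def sub (hE : E.Convergent) (I : Inst E) (X : List (Msg S)) (A : Msg S)
    (hX : X ⊆ I.nodes) (hA : A ∈ I.nodes) : Inst E where
  Γ := {B | B ∈ X}
  M := A
  nodes := (I.nodes.filter (· ∈ St (insert A {B | B ∈ X}))).reverse
  ptr := I.ptr
  finite := X.finite_toSet
  normal := by
    have : ∀ B ∈ I.nodes, E.Normal B := fun B hB => by
      refine Theory.Normal.of_mem_St hE ?_ ((I.mem_nodes B).1 hB)
      rintro C (rfl | hC)
      exacts [I.normal.2, I.normal.1 C hC]
    exact ⟨fun B hB => this B (hX hB), this A hA⟩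
  nodup := List.nodup_reverse.2 (I.nodup.filter _)
  mem_nodes T := by
    simp only [List.mem_reverse, List.mem_filter, decide_eq_true_eq, and_iff_right_iff_imp]
    exact fun h => I.St_subset_nodes hX hA h
  inj := I.inj.mono fun T hT => (I.mem_nodes T).1 (I.St_subset_nodes hX hA hT)

theorem size_sub_le (hE : E.Convergent) (I : Inst E) (X : List (Msg S)) (A : Msg S)
    (hX : X ⊆ I.nodes) (hA : A ∈ I.nodes) : (I.sub hE X A hX hA).size ≤ I.size := by
  rw [← length_nodes, ← length_nodes]
  simpa [sub] using List.length_filter_le _ _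

theorem one_le_size (I : Inst E) : 1 ≤ I.size := by
  rw [← I.length_nodes]
  exact List.length_pos_of_mem I.M_mem_nodes

end Inst

/-! ### Reading instances -/

section

variable {E : Theory S} {O κ : Type} {F : O → ℕ → ℕ} {I : κ → Inst E} {X : κ → List (Msg S)}
  {x : κ → Val} {a b d : κ → Msg S}

/-- The node `a k` of `I k` is accessible from `x k`. -/
structure Sees (F : O → ℕ → ℕ) (I : κ → Inst E) (x : κ → Val) (a : κ → Msg S) : Prop where
  mem : ∀ k, a k ∈ (I k).nodes
  comp : PComp F (fun k => (I k).size) x fun k => (I k).entry (a k)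

/-- The list of nodes of `I k`, and the list of the addresses of the nodes in `X k`, are
accessible from `x k`. -/
structure Reads (F : O → ℕ → ℕ) (I : κ → Inst E) (X : κ → List (Msg S)) (x : κ → Val) : Prop where
  comp : PComp F (fun k => (I k).size) x fun k => (I k).input
  subset : ∀ k, X k ⊆ (I k).nodes
  length : ∀ k, (X k).length ≤ (I k).nodes.length
  comp_list : PComp F (fun k => (I k).size) x fun k =>
    .list ((X k).map fun T => .atom ((I k).ptr T))

variable {κ' : Type} {x' : κ' → Val}

theorem Sees.reparam (h : Sees F I x a) (g : κ' → κ)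
    (hx : PComp F (fun k => (I (g k)).size) x' (x ∘ g)) : Sees F (I ∘ g) x' (a ∘ g) :=
  ⟨fun _ => h.mem _, hx.trans (h.comp.reparam g)⟩

theorem Reads.reparam (h : Reads F I X x) (g : κ' → κ)
    (hx : PComp F (fun k => (I (g k)).size) x' (x ∘ g)) : Reads F (I ∘ g) (X ∘ g) x' :=
  ⟨hx.trans (h.comp.reparam g), fun _ => h.subset _, fun _ => h.length _,
    hx.trans (h.comp_list.reparam g)⟩

theorem Sees.ptr (h : Sees F I x a) :
    PComp F (fun k => (I k).size) x fun k => .atom ((I k).ptr (a k)) := h.comp.fst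

theorem Sees.dec_hyp (h : Sees F I x a) :
    Dec F (fun k => (I k).size) x fun k => a k ∈ (I k).Γ := h.comp.snd.fst

theorem Sees.dec_target (h : Sees F I x a) :
    Dec F (fun k => (I k).size) x fun k => a k = (I k).M := h.comp.snd.snd.fst

theorem Sees.body (h : Sees F I x a) :
    PComp F (fun k => (I k).size) x fun k => nodeBody (I k).ptr (a k) := h.comp.snd.snd.snd

theorem Sees.dec_tag (h : Sees F I x a) (n : ℕ) :
    Dec F (fun k => (I k).size) x fun k => (a k).tag = n :=
  .atom_eq (h.body.fst.congr fun _ => Msg.nodeBody_fst _ _) (.const (.atom n))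

theorem Sees.dec_headCode (h : Sees F I x a) (n : ℕ) :
    Dec F (fun k => (I k).size) x fun k => (a k).headCode = n :=
  .atom_eq (h.body.snd.fst.congr fun _ => Msg.nodeBody_snd_fst _ _) (.const (.atom n))

theorem Sees.kids (h : Sees F I x a) : PComp F (fun k => (I k).size) x fun k =>
    .list ((a k).kids.map fun N => .atom ((I k).ptr N)) :=
  h.body.snd.snd.congr fun _ => Msg.nodeBody_snd_snd _ _

theorem Sees.dec_eq (ha : Sees F I x a) (hb : Sees F I x b) :
    Dec F (fun k => (I k).size) x fun k => a k = b k :=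
  (Dec.atom_eq ha.ptr hb.ptr).congr fun k => (I k).ptr_inj (ha.mem k) (hb.mem k)

/-- The first immediate subterm of `a k` has the address of `b k`. -/
theorem Sees.dec_kid₀ (ha : Sees F I x a) (hb : Sees F I x b) :
    Dec F (fun k => (I k).size) x fun k =>
      ((a k).kids.map (I k).ptr).headD 0 = (I k).ptr (b k) :=
  .atom_eq (ha.kids.fst.congr fun k => by
    rw [← Val.fst_list_atom, List.map_map]; rfl) hb.ptr

/-- The second immediate subterm of `a k` has the address of `b k`. -/
theorem Sees.dec_kid₁ (ha : Sees F I x a) (hb : Sees F I x b) :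
    Dec F (fun k => (I k).size) x fun k =>
      ((a k).kids.tail.map (I k).ptr).headD 0 = (I k).ptr (b k) :=
  .atom_eq (ha.kids.snd.fst.congr fun k => by
    rw [Val.snd_list_map, ← Val.fst_list_atom, List.map_map]; rfl) hb.ptr

/-- Head and child addresses determine a node, because children of nodes are nodes and addresses are
injective on nodes. The default address 0 in the child tests is harmless: the test of the head
ensures that both children exist. -/
theorem Sees.dec_con₂ (c : Con) (f : Msg S → Msg S → Msg S)
    (hf : ∀ M N, (f M N).tag = 1 ∧ (f M N).headCode = c.code ∧ (f M N).kids = [M, N])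
    (hf' : ∀ args, ∃ M N, .node (.inl c) args = f M N) (ha : Sees F I x a) (hb : Sees F I x b)
    (hd : Sees F I x d) : Dec F (fun k => (I k).size) x fun k => a k = f (b k) (d k) := by
  refine ((ha.dec_tag 1).and ((ha.dec_headCode c.code).and
    ((ha.dec_kid₀ hb).and (ha.dec_kid₁ hd)))).congr fun k => ⟨?_, fun h => ?_⟩
  · rintro ⟨h₁, h₂, h₃, h₄⟩
    obtain ⟨args, h⟩ := Msg.exists_args_of_headCode h₁ h₂
    obtain ⟨M, N, h'⟩ := hf' args
    rw [h'] at h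
    have hk := (hf M N).2.2
    rw [h, hk] at h₃ h₄
    have hm : ∀ T ∈ (f M N).kids, T ∈ (I k).nodes := fun T hT =>
      (I k).mem_nodes_of_imm (h ▸ ha.mem k) (Msg.mem_kids.1 hT)
    rw [h, ((I k).ptr_inj (hm M (by simp [hk])) (hb.mem k)).1 h₃,
      ((I k).ptr_inj (hm N (by simp [hk])) (hd.mem k)).1 h₄]
  · obtain ⟨h₁, h₂, h₃⟩ := hf (b k) (d k)
    rw [h, h₁, h₂, h₃]
    simp

theorem Sees.dec_pair (ha : Sees F I x a) (hb : Sees F I x b) (hd : Sees F I x d) :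
    Dec F (fun k => (I k).size) x fun k => a k = .pair (b k) (d k) :=
  Sees.dec_con₂ .pair _ (fun _ _ => ⟨rfl, rfl, rfl⟩) (fun args => ⟨_, _, Msg.node_pair args⟩)
    ha hb hd

theorem Sees.dec_enc (ha : Sees F I x a) (hb : Sees F I x b) (hd : Sees F I x d) :
    Dec F (fun k => (I k).size) x fun k => a k = .enc (b k) (d k) :=
  Sees.dec_con₂ .enc _ (fun _ _ => ⟨rfl, rfl, rfl⟩) (fun args => ⟨_, _, Msg.node_enc args⟩) ha hb hd

theorem Sees.dec_sign (ha : Sees F I x a) (hb : Sees F I x b) (hd : Sees F I x d) :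
    Dec F (fun k => (I k).size) x fun k => a k = .sign (b k) (d k) :=
  Sees.dec_con₂ .sign _ (fun _ _ => ⟨rfl, rfl, rfl⟩) (fun args => ⟨_, _, Msg.node_sign args⟩)
    ha hb hd

theorem Sees.dec_blind (ha : Sees F I x a) (hb : Sees F I x b) (hd : Sees F I x d) :
    Dec F (fun k => (I k).size) x fun k => a k = .blind (b k) (d k) :=
  Sees.dec_con₂ .blind _ (fun _ _ => ⟨rfl, rfl, rfl⟩) (fun args => ⟨_, _, Msg.node_blind args⟩)
    ha hb hd

theorem Sees.dec_pub (ha : Sees F I x a) (hb : Sees F I x b) :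
    Dec F (fun k => (I k).size) x fun k => a k = .pub (b k) := by
  refine ((ha.dec_tag 1).and ((ha.dec_headCode Con.pub.code).and
    (ha.dec_kid₀ hb))).congr fun k => ⟨?_, fun h => ?_⟩
  · rintro ⟨h₁, h₂, h₃⟩
    obtain ⟨args, h⟩ := Msg.exists_args_of_headCode h₁ h₂
    obtain ⟨M, hM⟩ : ∃ M, Msg.node (.inl .pub) args = .pub M := ⟨_, Msg.node_pub args⟩
    rw [hM] at h
    rw [h] at h₃
    rw [h]
    exact congrArg Msg.pub (((I k).ptr_inj ((I k).mem_nodes_of_imm (h ▸ ha.mem k)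
      (Msg.imm_pub _)) (hb.mem k)).1 h₃)
  · rw [h]
    exact ⟨rfl, rfl, rfl⟩

theorem Dec.mem_list (hX : PComp F (fun k => (I k).size) x fun k =>
      .list ((X k).map fun T => .atom ((I k).ptr T))) (C : ℕ)
    (hlen : ∀ k, (X k).length ≤ C * ((I k).size + 1)) (hsub : ∀ k, X k ⊆ (I k).nodes)
    (ha : PComp F (fun k => (I k).size) x fun k => .atom ((I k).ptr (a k)))
    (hmem : ∀ k, a k ∈ (I k).nodes) :
    Dec F (fun k => (I k).size) x fun k => a k ∈ X k := by
  refine (Dec.exists_mem X (fun k T => .atom ((I k).ptr T)) C hlen hX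
    (P := fun k T => (I k).ptr T = (I k).ptr (a k)) ?_).congr fun k => ⟨?_, fun h => ⟨_, h, rfl⟩⟩
  · exact fun g x' b hb hx he => .atom_eq he (hx.trans (ha.reparam g))
  · rintro ⟨T, hT, h⟩
    rwa [← ((I k).ptr_inj (hsub k hT) (hmem k)).1 h]

theorem Reads.dec_mem (h : Reads F I X x) (ha : Sees F I x a) :
    Dec F (fun k => (I k).size) x fun k => a k ∈ X k :=
  .mem_list h.comp_list 1 (fun k => by have := h.length k; rw [Inst.length_nodes] at this; omega)
    h.subset ha.ptr ha.mem

theorem Sees.dec_mem_kids (ha : Sees F I x a) (hb : Sees F I x b) :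
    Dec F (fun k => (I k).size) x fun k => b k ∈ (a k).kids := by
  obtain ⟨B, hB⟩ := Msg.length_kids_le S
  exact .mem_list ha.kids B (fun k => (hB _).trans (Nat.le_mul_of_pos_right _ (by omega)))
    (fun k T hT => (I k).mem_nodes_of_imm (ha.mem k) (Msg.mem_kids.1 hT)) hb.ptr hb.mem

theorem Dec.exists_node (hx : PComp F (fun k => (I k).size) x fun k => (I k).input)
    {P : κ → Msg S → Prop}
    (hP : ∀ {κ' : Type} (g : κ' → κ) (x' : κ' → Val) (a : κ' → Msg S),
      PComp F (fun k => (I (g k)).size) x' (x ∘ g) → Sees F (I ∘ g) x' a →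
      Dec F (fun k => (I (g k)).size) x' fun k => P (g k) (a k)) :
    Dec F (fun k => (I k).size) x fun k => ∃ T ∈ (I k).nodes, P k T :=
  .exists_mem (fun k => (I k).nodes) (fun k => (I k).entry) 1
    (fun k => by rw [Inst.length_nodes]; omega) hx
    fun g x' a ha hx he => hP g x' a hx ⟨ha, he⟩

theorem Reads.exists_node (h : Reads F I X x) {P : κ → Msg S → Prop}
    (hP : ∀ {κ' : Type} (g : κ' → κ) (x' : κ' → Val) (a : κ' → Msg S),
      PComp F (fun k => (I (g k)).size) x' (x ∘ g) → Reads F (I ∘ g) (X ∘ g) x' →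
      Sees F (I ∘ g) x' a → Dec F (fun k => (I (g k)).size) x' fun k => P (g k) (a k)) :
    Dec F (fun k => (I k).size) x fun k => ∃ T ∈ (I k).nodes, P k T :=
  .exists_node h.comp fun g x' a hx ha => hP g x' a hx (h.reparam g hx) ha

/-- Iterations that select nodes can be carried out by a program. -/
theorem Reads.iterate (h : Reads F I X x) {P : κ → Set (Msg S) → Msg S → Prop}
    (hP : ∀ {κ' : Type} (g : κ' → κ) (x' : κ' → Val) (Y : κ' → List (Msg S)) (a : κ' → Msg S),
      PComp F (fun k => (I (g k)).size) x' (x ∘ g) → Reads F (I ∘ g) Y x' →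
      Sees F (I ∘ g) x' a →
      Dec F (fun k => (I (g k)).size) x' fun k => P (g k) {b | b ∈ Y k} (a k)) :
    Reads F I (fun k => stage (I k).nodes (P k) (X k) (I k).nodes.length) x where
  comp := h.comp
  subset k := stage_subset (h.subset k) _
  length k := stage_length_le (h.length k) _
  comp_list := by
    refine PComp.iterate (fun k => (I k).nodes) (fun k => (I k).entry)
      (fun k T => .atom ((I k).ptr T)) P X 1 (fun k => by rw [Inst.length_nodes]; omega) h.comp
      h.subset h.length h.comp_list ?_
    intro κ' g x' Y a hY hY' ha hx hYc he
    exact ⟨hP g x' Y a hx ⟨hx.trans (h.comp.reparam g), hY, hY', hYc⟩ ⟨ha, he⟩, he.fst⟩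

open Classical in
theorem Reads.hyps (hx : PComp F (fun k => (I k).size) x fun k => (I k).input) :
    Reads F I (fun k => ((I k).nodes.filter (· ∈ (I k).Γ)).reverse) x where
  comp := hx
  subset k := fun a ha => by simp at ha; exact ha.1
  length k := by simpa using List.length_filter_le _ _
  comp_list := by
    refine PComp.filterMap (fun k => (I k).nodes) (fun k => (I k).entry)
      (fun k T => .atom ((I k).ptr T)) 1 (fun k => by rw [Inst.length_nodes]; omega) hx
      (P := fun k T => T ∈ (I k).Γ) ?_
    exact fun g x' a ha hx he => ⟨Sees.dec_hyp (I := I ∘ g) ⟨ha, he⟩, he.fst⟩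

/-- The search for the target of the instance. -/
theorem Reads.dec_target (h : Reads F I X x) :
    Dec F (fun k => (I k).size) x fun k => (I k).M ∈ X k := by
  refine (h.exists_node (P := fun k T => T = (I k).M ∧ T ∈ X k) ?_).congr fun k => ?_
  · exact fun g x' a _ h ha => ha.dec_target.and (h.dec_mem ha)
  · exact ⟨by rintro ⟨_, _, rfl, h⟩; exact h, fun h => ⟨_, (I k).M_mem_nodes, rfl, h⟩⟩

/-! ### Calls of the procedure for elementary deduction -/

/-- One step of the computation of the proper subterms of `insert A X`. -/
def subtermStep (nodes : List (Msg S)) (X : Set (Msg S)) (A : Msg S) (Y : Set (Msg S))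
    (B : Msg S) : Prop :=
  B ∈ Y ∨ ∃ C ∈ nodes, (C ∈ X ∨ C = A ∨ C ∈ Y) ∧ B ∈ C.kids

/-- The nodes that are proper subterms of `insert A X`. -/
noncomputable def Inst.subterms (I : Inst E) (X : List (Msg S)) (A : Msg S) : List (Msg S) :=
  stage I.nodes (subtermStep I.nodes {B | B ∈ X} A) [] I.nodes.length

theorem Inst.mem_subterms (I : Inst E) {X : List (Msg S)} {A : Msg S} (hX : X ⊆ I.nodes)
    (hA : A ∈ I.nodes) (B : Msg S) : B ∈ I.subterms X A ↔ B ∈ pst (insert A {B | B ∈ X}) := by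
  constructor
  · refine stage_induction (by simp) (fun Y hY C _ hC => ?_) _ B
    rcases hC with hC | ⟨D, -, hD, hC⟩
    · exact hY C hC
    · refine mem_pst_of_imm ?_ (Msg.mem_kids.1 hC)
      rcases hD with hD | rfl | hD
      · exact subset_St _ (.inr hD)
      · exact subset_St _ (.inl rfl)
      · exact pst_subset_St _ (hY D hD)
  · have closed : ∀ {B}, B ∈ I.nodes → _ → _ := fun hB h =>
      stage_closed (l := I.nodes) (P := subtermStep I.nodes {B | B ∈ X} A) (X₀ := []) (by simp)
        (fun _ _ h => .inl h) hB h
    rw [mem_pst_iff]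
    rintro ⟨N, hN, h⟩
    have hNn : N ∈ I.nodes := by
      rcases hN with rfl | hN
      exacts [hA, hX hN]
    induction h using Relation.TransGen.head_induction_on with
    | single h =>
      refine closed (I.mem_nodes_of_imm hNn h) (.inr ⟨N, hNn, ?_, Msg.mem_kids.2 h⟩)
      rcases hN with rfl | hN
      exacts [.inr (.inl rfl), .inl hN]
    | head h h' ih =>
      have := stage_subset (List.nil_subset _) _ ih
      exact closed (I.mem_nodes_of_imm this h) (.inr ⟨_, this, .inr (.inr ih), Msg.mem_kids.2 h⟩)

theorem Reads.subterms (h : Reads F I X x) (ha : Sees F I x a) :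
    Reads F I (fun k => (I k).subterms (X k) (a k)) x := by
  have h₀ : Reads F I (fun _ => []) x :=
    ⟨h.comp, by simp, by simp, (PComp.const (.atom 0)).congr fun _ => rfl⟩
  refine h₀.iterate ?_
  intro κ' g x' Y b hx hY hb
  refine (hY.dec_mem hb).or (hY.exists_node ?_)
  intro κ'' g' x'' c hx' hY' hc
  have hx'' := hx'.trans (hx.reparam g')
  have hX := h.reparam (g ∘ g') hx''
  exact ((hX.dec_mem hc).or ((hc.dec_eq (ha.reparam (g ∘ g') hx'')).or (hY'.dec_mem hc))).and
    (hc.dec_mem_kids (hb.reparam g' hx'))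

/-- The proper subterms come from an iteration, and the added signatures from a search over pairs of
nodes. -/
theorem Reads.dec_saturated (h : Reads F I X x) (ha : Sees F I x a) (hb : Sees F I x b) :
    Dec F (fun k => (I k).size) x fun k => b k ∈ St (insert (a k) {c | c ∈ X k}) := by
  have hY := h.subterms ha
  refine ((h.dec_mem hb).or ((hb.dec_eq ha).or ((hY.dec_mem hb).or (hY.exists_node
    (P := fun k T => ∃ U ∈ (I k).nodes, (T ∈ (I k).subterms (X k) (a k) ∧
      U ∈ (I k).subterms (X k) (a k)) ∧ b k = .sign T U) ?_)))).congr fun k => ?_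
  · intro κ' g x' c hx hY hc
    refine hY.exists_node ?_
    intro κ'' g' x'' d hx' hY' hd
    have hc' := hc.reparam g' hx'
    exact ((hY'.dec_mem hc').and (hY'.dec_mem hd)).and
      ((hb.reparam (g ∘ g') (hx'.trans (hx.reparam g'))).dec_sign hc' hd)
  · simp only [Inst.mem_subterms _ (h.subset k) (ha.mem k)]
    constructor
    · rintro (hb | hb | hb | ⟨T, -, U, -, ⟨hT, hU⟩, hb⟩)
      · exact subset_St _ (.inr hb)
      · exact subset_St _ (.inl hb)
      · exact pst_subset_St _ hb
      · exact hb ▸ sign_mem_St hT hU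
    · rintro (((hb | hb) | hb) | ⟨T, hT, U, hU, hb⟩)
      · exact .inr (.inl hb)
      · exact .inl hb
      · exact .inr (.inr (.inl hb))
      · exact .inr (.inr (.inr ⟨T, (I k).St_subset_nodes (h.subset k) (ha.mem k)
          (pst_subset_St _ hT), U, (I k).St_subset_nodes (h.subset k) (ha.mem k)
          (pst_subset_St _ hU), ⟨hT, hU⟩, hb⟩))

theorem Reads.sub_input (hE : E.Convergent) (h : Reads F I X x) (ha : Sees F I x a) :
    PComp F (fun k => (I k).size) x fun k =>
      ((I k).sub hE (X k) (a k) (h.subset k) (ha.mem k)).input := by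
  refine PComp.filterMap (fun k => (I k).nodes) (fun k => (I k).entry)
    (fun k => ((I k).sub hE (X k) (a k) (h.subset k) (ha.mem k)).entry) 1
    (fun k => by rw [Inst.length_nodes]; omega) h.comp
    (P := fun k T => T ∈ St (insert (a k) {c | c ∈ X k})) ?_
  intro κ' g x' b hb hx he
  have hb' : Sees F (I ∘ g) x' b := ⟨hb, he⟩
  have h' := h.reparam g hx
  have ha' := ha.reparam g hx
  -- Addresses and bodies are kept from the original graph; only the two tags are recomputed.
  exact ⟨h'.dec_saturated ha' hb',
    hb'.ptr.pair ((h'.dec_mem hb').pair ((hb'.dec_eq ha').pair hb'.body))⟩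

/-- The instances of a decision problem are decided within `O(F(n))` steps. -/
theorem Theory.HasComplexity.exists_prog {P : Set (Msg S) → Msg S → Prop} {F : ℕ → ℕ}
    (h : E.HasComplexity P F) : ∃ (p : Prog) (c : ℕ), ∀ I : Inst E,
      ∃ t ≤ c * F I.size, p.Runs I.input (Val.truth (P I.Γ I.M)) t := by
  obtain ⟨p, c, h⟩ := h
  exact ⟨p, c, fun I => h I.Γ I.M I.finite I.normal I.input
    ⟨I.nodes, I.ptr, I.nodup, I.mem_nodes, I.inj, rfl⟩⟩

theorem Reads.dec_elementary (hE : E.Convergent) (hF : ∀ o, Monotone (F o))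
    (hel : ∀ o, E.HasComplexity E.Elementary (F o)) (h : Reads F I X x) (ha : Sees F I x a) :
    Dec F (fun k => (I k).size) x fun k => E.Elementary {b | b ∈ X k} (a k) := by
  refine (h.sub_input hE ha).trans ?_
  refine ⟨0, fun o => ?_⟩
  obtain ⟨p, c, hp⟩ := (hel o).exists_prog
  refine ⟨p, c, fun k => ?_⟩
  obtain ⟨t, ht, hr⟩ := hp ((I k).sub hE (X k) (a k) (h.subset k) (ha.mem k))
  refine ⟨t, ht.trans (Nat.mul_le_mul_left c ?_), hr⟩
  exact (hF o (Inst.size_sub_le hE _ _ _ _ _)).trans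
    ((Nat.le_succ _).trans (Nat.le_mul_of_pos_left _ (by positivity)))

end

/-- A decision procedure in the calculus of polynomial overhead bounds the complexity. -/
theorem hasComplexity_of_dec {E : Theory S} {O : Type} {F f : O → ℕ → ℕ}
    {P : Set (Msg S) → Msg S → Prop}
    (h : Dec F (fun I : Inst E => I.size) (fun I => I.input) fun I => P I.Γ I.M)
    (hf : ∀ o, ∀ I : Inst E, F o I.size + 1 ≤ f o I.size) :
    ∃ k : ℕ, ∀ o, E.HasComplexity P fun n => n ^ k * f o n := by
  obtain ⟨k, h⟩ := h
  refine ⟨k, fun o => ?_⟩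
  obtain ⟨p, c, h⟩ := h o
  refine ⟨p, c * 2 ^ k, ?_⟩
  rintro Γ M hfin hn v ⟨nodes, ptr, h₁, h₂, h₃, rfl⟩
  set I : Inst E := ⟨Γ, M, nodes, ptr, hfin, hn, h₁, h₂, h₃⟩
  obtain ⟨t, ht, hr⟩ := h I
  refine ⟨t, ht.trans ?_, hr⟩
  change c * ((I.size + 1) ^ k * (F o I.size + 1)) ≤ c * 2 ^ k * (I.size ^ k * f o I.size)
  -- The target is itself a node, so the size is at least one and the shift by one costs a factor of
  -- at most `2 ^ k`.
  have h₁ : (I.size + 1) ^ k ≤ (2 * I.size) ^ k :=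
    Nat.pow_le_pow_left (by have := I.one_le_size; omega) k
  calc c * ((I.size + 1) ^ k * (F o I.size + 1))
      ≤ c * ((2 * I.size) ^ k * f o I.size) := by gcongr; exact hf o I
    _ = c * 2 ^ k * (I.size ^ k * f o I.size) := by rw [mul_pow]; ring

end IntruderDeduction

/-! ### Complexity of deducibility. -/

namespace IntruderDeduction

variable {S : Signature} {E : Theory S}

/-! ### Deducibility as an iteration over the nodes -/

/-- `A` is derivable from `X` in one step, where all messages involved are in `nodes`. -/
def DeductionStep (E : Theory S) (nodes : List (Msg S)) (X : Set (Msg S)) (A : Msg S) : Prop :=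
  A ∈ X ∨ E.Elementary X A ∨
  (∃ B ∈ nodes, ∃ C ∈ nodes, (B ∈ X ∧ C ∈ X) ∧
    (A = .pair B C ∨ A = .enc B C ∨ A = .sign B C ∨ A = .blind B C)) ∨
  (∃ B ∈ nodes, ∃ C ∈ nodes, B ∈ X ∧
    (B = .pair A C ∨ B = .pair C A ∨ (C ∈ X ∧ (B = .enc A C ∨ B = .blind A C)))) ∨
  (∃ B ∈ nodes, ∃ C ∈ nodes, ∃ K ∈ nodes, (B ∈ X ∧ C ∈ X) ∧ B = .sign A K ∧ C = .pub K) ∨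
  ∃ B ∈ nodes, ∃ C ∈ nodes, ∃ M ∈ nodes, ∃ R ∈ nodes, ∃ K ∈ nodes, (B ∈ X ∧ R ∈ X) ∧
    B = .sign C K ∧ C = .blind M R ∧ A = .sign M K

theorem DeductionStep.nder {nodes : List (Msg S)} {Γ X : Set (Msg S)} (hX : ∀ A ∈ X, E.NDer Γ A)
    {A : Msg S} (h : DeductionStep E nodes X A) : E.NDer Γ A := by
  rcases h with h | h | ⟨B, -, C, -, ⟨hB, hC⟩, h⟩ | ⟨B, -, C, -, hB, h⟩ |
    ⟨B, -, C, -, K, -, ⟨hB, hC⟩, rfl, rfl⟩ |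
    ⟨B, -, C, -, M, -, R, -, K, -, ⟨hB, hR⟩, rfl, rfl, rfl⟩
  · exact hX A h
  · exact h.nder.trans hX
  · rcases h with rfl | rfl | rfl | rfl
    · exact .pairI (hX _ hB) (hX _ hC)
    · exact .encI (hX _ hB) (hX _ hC)
    · exact .signI (hX _ hB) (hX _ hC)
    · exact .blindI (hX _ hB) (hX _ hC)
  · rcases h with rfl | rfl | ⟨hC, rfl | rfl⟩
    · exact .pairE₁ (hX _ hB)
    · exact .pairE₂ (hX _ hB)
    · exact .encE (hX _ hB) (hX _ hC)
    · exact .blindE₁ (hX _ hB) (hX _ hC)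
  · exact .signE (hX _ hB) (hX _ hC)
  · exact .blindE₂ (hX _ hB) (hX _ hR)

section

variable {I : Inst E} {D : Set (Msg S)}

/-- Right rules, read upwards, pass to immediate subterms, so all messages in the derivation of a
node are nodes. -/
theorem Inst.mem_of_rder (hD : ∀ A ∈ I.nodes, DeductionStep E I.nodes D A → A ∈ D)
    {Γ : Set (Msg S)} (hΓ : Γ ⊆ D) {A : Msg S} (h : E.RDer Γ A) (hA : A ∈ I.nodes) : A ∈ D := by
  induction h with
  | id h => exact hD _ hA (.inr (.inl (h.mono hΓ)))
  | @pairR M N _ _ h₁ h₂ =>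
    have hM := I.mem_nodes_of_imm hA (Msg.imm_pair_left M N)
    have hN := I.mem_nodes_of_imm hA (Msg.imm_pair_right M N)
    exact hD _ hA (.inr (.inr (.inl ⟨M, hM, N, hN, ⟨h₁ hM, h₂ hN⟩, .inl rfl⟩)))
  | @encR M N _ _ h₁ h₂ =>
    have hM := I.mem_nodes_of_imm hA (Msg.imm_enc_left M N)
    have hN := I.mem_nodes_of_imm hA (Msg.imm_enc_right M N)
    exact hD _ hA (.inr (.inr (.inl ⟨M, hM, N, hN, ⟨h₁ hM, h₂ hN⟩, .inr (.inl rfl)⟩)))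
  | @signR M N _ _ h₁ h₂ =>
    have hM := I.mem_nodes_of_imm hA (Msg.imm_sign_left M N)
    have hN := I.mem_nodes_of_imm hA (Msg.imm_sign_right M N)
    exact hD _ hA (.inr (.inr (.inl ⟨M, hM, N, hN, ⟨h₁ hM, h₂ hN⟩, .inr (.inr (.inl rfl))⟩)))
  | @blindR M N _ _ h₁ h₂ =>
    have hM := I.mem_nodes_of_imm hA (Msg.imm_blind_left M N)
    have hN := I.mem_nodes_of_imm hA (Msg.imm_blind_right M N)
    exact hD _ hA (.inr (.inr (.inl ⟨M, hM, N, hN, ⟨h₁ hM, h₂ hN⟩, .inr (.inr (.inr rfl))⟩)))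

theorem Inst.mem_pst_of_imm (I : Inst E) {A B : Msg S} (hB : B ∈ I.nodes) (h : A.Imm B) :
    A ∈ pst (insert I.M I.Γ) :=
  IntruderDeduction.mem_pst_of_imm ((I.mem_nodes B).1 hB) h

theorem Inst.sign_mem_nodes (I : Inst E) {A B : Msg S} (hA : A ∈ pst (insert I.M I.Γ))
    (hB : B ∈ pst (insert I.M I.Γ)) : .sign A B ∈ I.nodes :=
  (I.mem_nodes _).2 (sign_mem_St hA hB)

/-- Each left rule adds only nodes, and a step of natural deduction on nodes produces every one of
them, so the hypotheses never leave `D`. -/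
theorem Inst.mem_of_lder (hDn : ∀ A ∈ D, A ∈ I.nodes)
    (hD : ∀ A ∈ I.nodes, DeductionStep E I.nodes D A → A ∈ D)
    {Γ : Set (Msg S)} {T : Msg S} (h : E.LDer Γ T) (hΓ : Γ ⊆ D) (hT : T ∈ I.nodes) : T ∈ D := by
  induction h with
  | r h => exact Inst.mem_of_rder hD hΓ h hT
  | @le Γ M K T h hK _ ih =>
    have hn := hDn _ (hΓ h)
    have hMn := I.mem_nodes_of_imm hn (Msg.imm_enc_left M K)
    have hKn := I.mem_nodes_of_imm hn (Msg.imm_enc_right M K)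
    have hKD := Inst.mem_of_rder hD hΓ hK hKn
    have hMD := hD _ hMn (.inr (.inr (.inr (.inl
      ⟨_, hn, K, hKn, hΓ h, .inr (.inr ⟨hKD, .inl rfl⟩)⟩))))
    exact ih (Set.insert_subset hMD (Set.insert_subset hKD hΓ)) hT
  | @lp Γ M N T h _ ih =>
    have hn := hDn _ (hΓ h)
    have hMn := I.mem_nodes_of_imm hn (Msg.imm_pair_left M N)
    have hNn := I.mem_nodes_of_imm hn (Msg.imm_pair_right M N)
    have hMD := hD _ hMn (.inr (.inr (.inr (.inl ⟨_, hn, N, hNn, hΓ h, .inl rfl⟩))))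
    have hND := hD _ hNn (.inr (.inr (.inr (.inl ⟨_, hn, M, hMn, hΓ h, .inr (.inl rfl)⟩))))
    exact ih (Set.insert_subset hMD (Set.insert_subset hND hΓ)) hT
  | @sign Γ M K L T h h' hKL _ ih =>
    have hn := hDn _ (hΓ h)
    have hn' := hDn _ (hΓ h')
    have hM := I.mem_pst_of_imm hn (Msg.imm_sign_left M K)
    have hL := I.mem_pst_of_imm hn' (Msg.imm_pub L)
    have hs := I.sign_mem_nodes hM hL
    -- The keys `K` and `L` agree only modulo AC, whereas `DeductionStep` compares nodes by
    -- identity. The signature with `L` is also a node of the saturated set, and elementary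
    -- deduction obtains it from the one with `K`.
    have hsD : .sign M L ∈ D := hD _ hs (.inr (.inl
      ((Theory.Elementary.mem (hΓ h)).conv (Theory.Eqv.congr (.inl .sign) fun i => by
        change Fin 2 at i
        fin_cases i
        exacts [Theory.Eqv.refl _, hKL.eqv]))))
    have hMD := hD _ (I.mem_nodes_of_imm hn (Msg.imm_sign_left M K))
      (.inr (.inr (.inr (.inr (.inl ⟨_, hs, _, hn', L, I.mem_nodes_of_imm hn' (Msg.imm_pub L),
        ⟨hsD, hΓ h'⟩, rfl, rfl⟩)))))
    exact ih (Set.insert_subset hMD hΓ) hT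
  | @blind₁ Γ M K T h hK _ ih =>
    have hn := hDn _ (hΓ h)
    have hMn := I.mem_nodes_of_imm hn (Msg.imm_blind_left M K)
    have hKn := I.mem_nodes_of_imm hn (Msg.imm_blind_right M K)
    have hKD := Inst.mem_of_rder hD hΓ hK hKn
    have hMD := hD _ hMn (.inr (.inr (.inr (.inl
      ⟨_, hn, K, hKn, hΓ h, .inr (.inr ⟨hKD, .inr rfl⟩)⟩))))
    exact ih (Set.insert_subset hMD (Set.insert_subset hKD hΓ)) hT
  | @blind₂ Γ M R K T h hR _ ih =>
    have hn := hDn _ (hΓ h)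
    have hBn := I.mem_nodes_of_imm hn (Msg.imm_sign_left (.blind M R) K)
    have hKn := I.mem_nodes_of_imm hn (Msg.imm_sign_right (.blind M R) K)
    have hMn := I.mem_nodes_of_imm hBn (Msg.imm_blind_left M R)
    have hRn := I.mem_nodes_of_imm hBn (Msg.imm_blind_right M R)
    have hRD := Inst.mem_of_rder hD hΓ hR hRn
    have hsD := hD _ (I.sign_mem_nodes (I.mem_pst_of_imm hBn (Msg.imm_blind_left M R))
      (I.mem_pst_of_imm hn (Msg.imm_sign_right (.blind M R) K)))
      (.inr (.inr (.inr (.inr (.inr ⟨_, hn, _, hBn, M, hMn, R, hRn, K, hKn, ⟨hΓ h, hRD⟩,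
        rfl, rfl, rfl⟩)))))
    exact ih (Set.insert_subset hsD (Set.insert_subset hRD hΓ)) hT
  | @ls Γ A M h hA _ ih =>
    have hsub : insert M Γ ⊆ St (insert I.M I.Γ) := by
      rintro B (rfl | hB)
      exacts [(I.mem_nodes _).1 hT, (I.mem_nodes _).1 (hDn _ (hΓ hB))]
    have hAD := Inst.mem_of_rder hD hΓ hA
      ((I.mem_nodes _).2 (pst_subset_St _ (mem_pst_of_factorOf hsub h)))
    exact ih (Set.insert_subset hAD hΓ) hT

end

open Classical in
/-- The nodes that are hypotheses. -/
noncomputable def Inst.hyps (I : Inst E) : List (Msg S) := (I.nodes.filter (· ∈ I.Γ)).reverse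

theorem Inst.mem_hyps (I : Inst E) {A : Msg S} : A ∈ I.hyps ↔ A ∈ I.Γ := by
  simpa [hyps] using I.mem_nodes_of_mem

theorem Inst.hyps_subset (I : Inst E) : I.hyps ⊆ I.nodes :=
  fun _ h => I.mem_nodes_of_mem (I.mem_hyps.1 h)

/-- Selected nodes are deducible step by step. The converse goes through the linear system, since a
natural deduction may leave the saturated set. -/
theorem Inst.mem_deducible_iff (hE : E.Convergent) (I : Inst E) :
    I.M ∈ stage I.nodes (DeductionStep E I.nodes) I.hyps I.nodes.length ↔ E.NDer I.Γ I.M := by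
  constructor
  · exact stage_induction (fun A hA => .id (I.mem_hyps.1 hA)) (fun X hX A _ hA => hA.nder hX) _ _
  · intro h
    exact Inst.mem_of_lder (D := {A | A ∈ stage I.nodes (DeductionStep E I.nodes) I.hyps
      I.nodes.length}) (fun A hA => stage_subset I.hyps_subset _ hA)
      (fun A hA => stage_closed I.hyps_subset (fun _ _ h => .inl h) hA)
      (hE.lder_of_nder I.finite I.normal h)
      (fun A hA => stage_mono I.hyps_subset (fun _ _ h => .inl h) (Nat.zero_le _)
        (I.mem_hyps.2 hA)) I.M_mem_nodes

theorem Reads.dec_deductionStep (hE : E.Convergent) {O κ : Type} {F : O → ℕ → ℕ} {I : κ → Inst E}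
    {X : κ → List (Msg S)} {x : κ → Val} {a : κ → Msg S} (hF : ∀ o, Monotone (F o))
    (hel : ∀ o, E.HasComplexity E.Elementary (F o)) (h : Reads F I X x) (ha : Sees F I x a) :
    Dec F (fun k => (I k).size) x fun k => DeductionStep E (I k).nodes {b | b ∈ X k} (a k) := by
  refine (h.dec_mem ha).or ((h.dec_elementary hE hF hel ha).or (.or ?_ (.or ?_ (.or ?_ ?_))))
  · refine h.exists_node fun g₁ x₁ b hx₁ h b_ => h.exists_node fun g₂ x₂ c hx₂ h c_ => ?_
    have a_ := (ha.reparam g₁ hx₁).reparam g₂ hx₂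
    replace b_ := b_.reparam g₂ hx₂
    exact ((h.dec_mem b_).and (h.dec_mem c_)).and ((a_.dec_pair b_ c_).or ((a_.dec_enc b_ c_).or
      ((a_.dec_sign b_ c_).or (a_.dec_blind b_ c_))))
  · refine h.exists_node fun g₁ x₁ b hx₁ h b_ => h.exists_node fun g₂ x₂ c hx₂ h c_ => ?_
    have a_ := (ha.reparam g₁ hx₁).reparam g₂ hx₂
    replace b_ := b_.reparam g₂ hx₂
    exact (h.dec_mem b_).and ((b_.dec_pair a_ c_).or ((b_.dec_pair c_ a_).or
      ((h.dec_mem c_).and ((b_.dec_enc a_ c_).or (b_.dec_blind a_ c_)))))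
  · refine h.exists_node fun g₁ x₁ b hx₁ h b_ => h.exists_node fun g₂ x₂ c hx₂ h c_ =>
      h.exists_node fun g₃ x₃ d hx₃ h d_ => ?_
    have a_ := ((ha.reparam g₁ hx₁).reparam g₂ hx₂).reparam g₃ hx₃
    replace b_ := (b_.reparam g₂ hx₂).reparam g₃ hx₃
    replace c_ := c_.reparam g₃ hx₃
    exact ((h.dec_mem b_).and (h.dec_mem c_)).and ((b_.dec_sign a_ d_).and (c_.dec_pub d_))
  · refine h.exists_node fun g₁ x₁ b hx₁ h b_ => h.exists_node fun g₂ x₂ c hx₂ h c_ =>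
      h.exists_node fun g₃ x₃ m hx₃ h m_ => h.exists_node fun g₄ x₄ r hx₄ h r_ =>
      h.exists_node fun g₅ x₅ d hx₅ h d_ => ?_
    have a_ := ((((ha.reparam g₁ hx₁).reparam g₂ hx₂).reparam g₃ hx₃).reparam g₄ hx₄).reparam g₅ hx₅
    replace b_ := (((b_.reparam g₂ hx₂).reparam g₃ hx₃).reparam g₄ hx₄).reparam g₅ hx₅
    replace c_ := ((c_.reparam g₃ hx₃).reparam g₄ hx₄).reparam g₅ hx₅
    replace m_ := (m_.reparam g₄ hx₄).reparam g₅ hx₅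
    replace r_ := r_.reparam g₅ hx₅
    exact ((h.dec_mem b_).and (h.dec_mem r_)).and ((b_.dec_sign c_ d_).and
      ((c_.dec_blind m_ r_).and (a_.dec_sign m_ d_)))

theorem Prog.Runs.one_le {p : Prog} {x y : Val} {t : ℕ} (h : p.Runs x y t) : 1 ≤ t := by
  cases h <;> omega

/-- Every run takes a step, so the bound is positive at every size that occurs; this lets the
summand 1 in `cost` be absorbed into a factor 2. -/
theorem Inst.one_le_of_hasComplexity {P : Set (Msg S) → Msg S → Prop} {f : ℕ → ℕ}
    (h : E.HasComplexity P f) (I : Inst E) : 1 ≤ f I.size := by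
  obtain ⟨p, c, h⟩ := h.exists_prog
  obtain ⟨t, ht, hr⟩ := h I
  exact Nat.pos_of_ne_zero fun h₀ => by
    have := hr.one_le
    rw [h₀] at ht
    omega

theorem Theory.Convergent.polyReducible_nder (hE : E.Convergent) : E.PolyReducible E.NDer := by
  -- All admissible bounds are treated at once, so that the exponent `k` does not depend on `f`.
  let O := {f : ℕ → ℕ // Monotone f ∧ E.HasComplexity E.Elementary f}
  have hx : PComp (fun o : O => o.1) (fun I : Inst E => I.size) (fun I => I.input)
      fun I => I.input := .refl _
  have hstage := (Reads.hyps (I := fun I : Inst E => I) hx).iterate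
    (P := fun I => DeductionStep E I.nodes) fun g x' Y a hx hY ha =>
      hY.dec_deductionStep hE (fun o => o.2.1) (fun o => o.2.2) ha
  obtain ⟨k, hk⟩ := hasComplexity_of_dec (f := fun o n => 2 * o.1 n) (P := E.NDer)
    (hstage.dec_target.congr fun I => I.mem_deducible_iff hE)
    fun o I => by have := I.one_le_of_hasComplexity o.2.2; omega
  refine ⟨k, fun f hf hel => ?_⟩
  obtain ⟨p, c, h⟩ := hk ⟨f, hf, hel⟩
  refine ⟨p, c * 2, fun Γ M hΓ hn v hv => ?_⟩
  obtain ⟨t, ht, hr⟩ := h Γ M hΓ hn v hv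
  exact ⟨t, ht.trans (le_of_eq (by ring)), hr⟩

/-! ### Elementary deduction without equations -/

theorem Theory.NoEquations.eq_of_eqv (h : E.NoEquations) {M N : Msg S} (hMN : E.Eqv M N) :
    M = N := by
  have hA : E.rules ∪ E.acAxioms = ∅ := by
    simp [h.1, Theory.acAxioms, h.2]
  induction hMN with
  | rel M N h =>
    rw [hA] at h
    exfalso
    induction h with
    | root e he => exact he
    | arg _ _ _ _ _ ih => exact ih
  | refl => rfl
  | symm _ _ _ ih => exact ih.symm
  | trans _ _ _ _ _ ih₁ ih₂ => exact ih₁.trans ih₂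

/-- `A` belongs to `X` or is obtained from `X` by a symbol of the equational theory. -/
def ContextStep (X : Set (Msg S)) (A : Msg S) : Prop :=
  A ∈ X ∨ A.tag = 2 ∧ ∀ B ∈ A.kids, B ∈ X

/-- Equality is now syntactic, so the context is an initial part of the target and its intermediate
values are subterms of the target, hence nodes. -/
theorem Inst.mem_context_iff (h : E.NoEquations) (I : Inst E) :
    I.M ∈ stage I.nodes ContextStep I.hyps I.nodes.length ↔ E.Elementary I.Γ I.M := by
  constructor
  · refine stage_induction (fun A hA => .mem (I.mem_hyps.1 hA)) (fun X hX A _ hA => ?_) _ _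
    rcases hA with hA | ⟨hA, hk⟩
    · exact hX A hA
    · match A, hA with
      | .node (.inr f) args, _ =>
        exact .app fun i => hX _ (hk _ (Msg.mem_kids.2 (imm_node args i)))
  · rintro ⟨k, C, Ms, hMs, heq⟩
    replace heq := h.eq_of_eqv heq
    have key : C.subst Ms ∈ I.nodes →
        C.subst Ms ∈ stage I.nodes ContextStep I.hyps I.nodes.length := by
      clear heq
      induction C with
      | var i =>
        exact fun _ => stage_mono I.hyps_subset (fun _ _ h => .inl h) (Nat.zero_le _)
          (I.mem_hyps.2 (hMs i))
      | app f args ih =>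
        intro hn
        refine stage_closed I.hyps_subset (fun _ _ h => .inl h) hn (.inr ⟨rfl, fun B hB => ?_⟩)
        obtain ⟨i, rfl⟩ := (List.mem_ofFn' _ _).1 hB
        exact ih i (I.mem_nodes_of_imm hn (imm_node (g := .inr f) _ i))
    rw [heq] at key
    exact key I.M_mem_nodes

theorem Theory.NoEquations.exists_hasComplexity_elementary (h : E.NoEquations) :
    ∃ k : ℕ, E.HasComplexity E.Elementary fun n => n ^ k := by
  -- No subroutine is called here, so the bound for calls is zero and `cost` is a plain polynomial.
  have hx : PComp (fun (_ : Unit) _ => 0) (fun I : Inst E => I.size) (fun I => I.input)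
      fun I => I.input := .refl _
  have hstage := (Reads.hyps (I := fun I : Inst E => I) hx).iterate
    (P := fun _ => ContextStep) fun g x' Y a hx hY ha => by
      refine (hY.dec_mem ha).or ((ha.dec_tag 2).and (Dec.congr (Dec.not (hY.exists_node
        (P := fun k T => T ∈ (a k).kids ∧ ¬ T ∈ Y k) ?_)) fun k => ?_))
      · exact fun g x' b hx hY hb => ((ha.reparam g hx).dec_mem_kids hb).and (hY.dec_mem hb).not
      · push Not
        exact ⟨fun h B hB => h B (Inst.mem_nodes_of_imm _ (ha.mem k) (Msg.mem_kids.1 hB)) hB,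
          fun h B _ hB => h B hB⟩
  obtain ⟨k, hk⟩ := hasComplexity_of_dec (f := fun _ _ => 1) (P := E.Elementary)
    (hstage.dec_target.congr fun I => I.mem_context_iff h) fun _ _ => le_rfl
  exact ⟨k, by simpa using hk ()⟩

theorem Theory.HasComplexity.congr {P Q : Set (Msg S) → Msg S → Prop} {f : ℕ → ℕ}
    (h : E.HasComplexity P f)
    (hPQ : ∀ Γ M, Γ.Finite → E.NormalSequent Γ M → (P Γ M ↔ Q Γ M)) : E.HasComplexity Q f := by
  obtain ⟨p, c, h⟩ := h
  refine ⟨p, c, fun Γ M hΓ hn v hv => ?_⟩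
  rw [← propext (hPQ Γ M hΓ hn)]
  exact h Γ M hΓ hn v hv

end IntruderDeduction

/-! ### Equivalence, reduction and the equation-free case combined. -/

theorem mainTheorem1 (S : IntruderDeduction.Signature) (E : IntruderDeduction.Theory S)
    (hE : E.Convergent) :
    (∀ (Γ : Set (IntruderDeduction.Msg S)) (M : IntruderDeduction.Msg S),
      Γ.Finite → E.NormalSequent Γ M →
        ((E.LDer Γ M ↔ E.SDer Γ M) ∧ (E.SDer Γ M ↔ E.NDer Γ M))) ∧
    (E.PolyReducible E.LDer ∧ E.PolyReducible E.SDer ∧ E.PolyReducible E.NDer) ∧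
    (E.NoEquations →
      ∃ k : ℕ, E.HasComplexity E.LDer (fun n => n ^ k) ∧
        E.HasComplexity E.SDer (fun n => n ^ k) ∧
        E.HasComplexity E.NDer (fun n => n ^ k)) := by
  have hNL : ∀ Γ M, Γ.Finite → E.NormalSequent Γ M → (E.NDer Γ M ↔ E.LDer Γ M) :=
    fun Γ M hΓ hn => ⟨hE.lder_of_nder hΓ hn, fun h => h.sder.nder⟩
  have hNS : ∀ Γ M, Γ.Finite → E.NormalSequent Γ M → (E.NDer Γ M ↔ E.SDer Γ M) :=
    fun Γ M hΓ hn => ⟨fun h => (hE.lder_of_nder hΓ hn h).sder, fun h => h.nder⟩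
  refine ⟨fun Γ M hΓ hn => ⟨(hNL Γ M hΓ hn).symm.trans (hNS Γ M hΓ hn), (hNS Γ M hΓ hn).symm⟩,
    ?_, fun hno => ?_⟩
  · obtain ⟨k, h⟩ := hE.polyReducible_nder
    exact ⟨⟨k, fun f hf hel => (h f hf hel).congr hNL⟩, ⟨k, fun f hf hel => (h f hf hel).congr hNS⟩,
      ⟨k, h⟩⟩
  · obtain ⟨j, hj⟩ := hno.exists_hasComplexity_elementary
    obtain ⟨k, h⟩ := hE.polyReducible_nder
    have hN := h (fun n => n ^ j) (fun _ _ hab => Nat.pow_le_pow_left hab j) hj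
    simp only [← pow_add] at hN
    exact ⟨k + j, hN.congr hNL, hN.congr hNS, hN⟩
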